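/- **Theorem.** For every integer $N \ge 1$ there is a non-empty open set $U \subset \mathbb{R}^4$ such that the following holds for every $r \in \{1,2,\dots,\infty\}$, every $(\tau_L,\delta_L,\tau_R,\delta_R) \in U$ and every piecewise-$C^r$ family of maps $x \mapsto f(x;\mu)$ of $\mathbb{R}^2$, $\mu \in \mathbb{R}$, that near $(x;\mu)=(0;0)$ has the form $$ f(x;\mu) = \begin{cases} \begin{bmatrix} \tau_L x_1 + x_2 + \mu \\ -\delta_L x_1 \end{bmatrix} + E_L(x;\mu), & x_1 \le 0, \\[2ex] \begin{bmatrix} \tau_R x_1 + x_2 + \mu \\ -\delta_R x_1 \end{bmatrix} + E_R(x;\mu), & x_1 \ge 0 \end{cases} $$ (both formulas hold where $x_1 = 0$). Here, on a neighbourhood of $(0;0)$, the terms $E_L, E_R$ are $C^1$ functions of $(x;\mu)$, are $C^r$ functions of $x$ for each fixed $\mu$, and are $o(\|x\|+|\mu|)$ as $(x;\mu) \to (0;0)$. There exist $\mu_0 > 0$ and an integer $m \ge 1$ such that 1. for all $\mu \in (-\mu_0,0)$, the map $f(\,\cdot\,;\mu)$ has an asymptotically stable fixed point; 2. for all $\mu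 \in (0,\mu_0)$, the map $f(\,\cdot\,;\mu)$ has $N$ pairwise disjoint non-empty trapping regions on each of which its $m$-th iterate is piecewise-$C^r$ and expanding. *Definitions.* A trapping region of $f$ is a compact set $\Omega$ with $f(\Omega) \subset \mathrm{int}(\Omega)$. A map $g : \Omega \to \Omega$ of a compact set $\Omega \subset \mathbb{R}^2$ is piecewise-$C^r$ if there are finitely many mutually disjoint open connected non-empty sets $\Omega_i \subset \Omega$ such that (i) the boundary of each $\Omega_i$ is a union of finitely many pairwise disjoint piecewise-$C^r$ simple closed curves, (ii) $\Omega = \bigcup_i \overline{\Omega_i}$, and (iii) $g$ is $C^r$ on each $\Omega_i$ and the restriction $g|_{\Omega_i}$ extends to a $C^r$ map on a neighbourhood of $\overline{\Omega_i}$. A piecewise-$C^r$ simple closed curve is a closed chain of finitely many regular $C^r$ arcs with no coincidences other than common end points of consecutive arcs. Such a $g$ is expanding if, for these $\Omega_i$, there is $\lambda > 1$ with $\|\mathrm{D}g(x)v\| \ge \lambda \|v\|$ (Euclidean norm) for all $x \in \bigcup_i \Omega_i$ and all $v \in \mathbb{R}^2$. -/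

import Mathlib

open Set Filter Topology Asymptotics

/-- The Euclidean plane `ℝ²`; the components `x₁, x₂` of a point are `x 0, x 1`. -/
abbrev Plane : Type := EuclideanSpace ℝ (Fin 2)

/-- A linear piece of the two-dimensional border-collision normal form:
`(x₁, x₂) ↦ (τ x₁ + x₂ + μ, -δ x₁)`. -/
noncomputable def normalFormPiece (τ δ μ : ℝ) (x : Plane) : Plane :=
  !₂[τ * x 0 + x 1 + μ, -δ * x 0]

/-- `IsHigherOrder r W E` : on the neighbourhood `W` of the origin of `(x; μ)`-space, the term
`E(x; μ)` is jointly `C¹`, is `C^r` as a function of the state `x` for every fixed value of the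
parameter `μ`, and is `o(‖x‖ + |μ|)` as `(x; μ) → (0; 0)`. -/
structure IsHigherOrder (r : ℕ∞) (W : Set (Plane × ℝ)) (E : Plane → ℝ → Plane) : Prop where
  contDiffOn_one : ContDiffOn ℝ 1 (fun p : Plane × ℝ => E p.1 p.2) W
  contDiffOn_state : ∀ μ : ℝ, ContDiffOn ℝ r (fun x => E x μ) {x | (x, μ) ∈ W}
  isLittleO : (fun p : Plane × ℝ => E p.1 p.2) =o[𝓝 0] (fun p : Plane × ℝ => ‖p.1‖ + |p.2|)

/-- `f` (with `f μ x` standing for `f(x; μ)`) is a piecewise-`C^r` border-collision map with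
higher-order terms and parameters `τL, δL, τR, δR`. The form is only asked for near
`(x; μ) = (0; 0)`, where the bifurcation takes place. On the switching manifold `x₁ = 0` both
formulas have to hold, so `f` is continuous there. -/
def IsBorderCollisionMap (r : ℕ∞) (τL δL τR δR : ℝ) (f : ℝ → Plane → Plane) : Prop :=
  ∃ (W : Set (Plane × ℝ)) (EL ER : Plane → ℝ → Plane),
    IsOpen W ∧ (0 : Plane × ℝ) ∈ W ∧ IsHigherOrder r W EL ∧ IsHigherOrder r W ER ∧
    ∀ (x : Plane) (μ : ℝ), (x, μ) ∈ W →
      (x 0 ≤ 0 → f μ x = normalFormPiece τL δL μ x + EL x μ) ∧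
      (0 ≤ x 0 → f μ x = normalFormPiece τR δR μ x + ER x μ)

/-- `x` is a fixed point of `f` that is Lyapunov stable and locally attracting. -/
structure IsAsymptoticallyStableFixedPoint (f : Plane → Plane) (x : Plane) : Prop where
  isFixedPt : Function.IsFixedPt f x
  stable : ∀ ε > 0, ∃ η > 0, ∀ y, dist y x < η → ∀ n : ℕ, dist (f^[n] y) x < ε
  attracting : ∃ η > 0, ∀ y, dist y x < η → Tendsto (fun n : ℕ => f^[n] y) atTop (𝓝 x)

/-- A compact set that is mapped into its own interior. -/
structure IsTrappingRegion (f : Plane → Plane) (Ω : Set Plane) : Prop where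
  isCompact : IsCompact Ω
  image_subset : f '' Ω ⊆ interior Ω

/-- `Γ` is a piecewise-`C^r` simple closed curve: a closed chain of `p + 1` regular `C^r` arcs
`γ 0, …, γ p`, each parametrised by `[0, 1]`, each ending where the next one starts (cyclically:
the addition in `Fin (p + 1)` wraps around), with no other coincidences. -/
def IsPiecewiseCrClosedCurve (r : ℕ∞) (Γ : Set Plane) : Prop :=
  ∃ (p : ℕ) (γ : Fin (p + 1) → ℝ → Plane),
    (∀ j, ContDiffOn ℝ r (γ j) (Icc 0 1)) ∧
    (∀ j, ∀ s ∈ Icc (0 : ℝ) 1, derivWithin (γ j) (Icc 0 1) s ≠ 0) ∧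
    (∀ j, γ j 1 = γ (j + 1) 0) ∧
    (∀ i j, ∀ s ∈ Ico (0 : ℝ) 1, ∀ t ∈ Ico (0 : ℝ) 1, γ i s = γ j t → i = j ∧ s = t) ∧
    Γ = ⋃ j, γ j '' Icc 0 1

/-- The boundary of `S` consists of finitely many pairwise disjoint piecewise-`C^r` simple closed
curves. -/
def HasPiecewiseCrBoundary (r : ℕ∞) (S : Set Plane) : Prop :=
  ∃ (c : ℕ) (Γ : Fin c → Set Plane),
    (∀ i, IsPiecewiseCrClosedCurve r (Γ i)) ∧ (Pairwise fun i j => Disjoint (Γ i) (Γ j)) ∧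
    frontier S = ⋃ i, Γ i

/-- The map `g : Ω → Ω` on the compact set `Ω` is piecewise-`C^r`, as witnessed by the finitely
many mutually disjoint open regions `R 0, …, R (q - 1)` in `Ω`. -/
structure IsPiecewiseCrWith (r : ℕ∞) (g : Plane → Plane) (Ω : Set Plane) {q : ℕ}
    (R : Fin q → Set Plane) : Prop where
  isCompact : IsCompact Ω
  mapsTo : MapsTo g Ω Ω
  isOpen : ∀ i, IsOpen (R i)
  isConnected : ∀ i, IsConnected (R i)
  subset : ∀ i, R i ⊆ Ω
  disjoint : Pairwise fun i j => Disjoint (R i) (R j)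
  boundary : ∀ i, HasPiecewiseCrBoundary r (R i)
  union_closure : Ω = ⋃ i, closure (R i)
  contDiffOn : ∀ i, ContDiffOn ℝ r g (R i)
  extension : ∀ i, ∃ (V : Set Plane) (G : Plane → Plane),
    IsOpen V ∧ closure (R i) ⊆ V ∧ ContDiffOn ℝ r G V ∧ EqOn G g (R i)

/-- `g` expands all tangent vectors, uniformly over the union of the regions `R i`. -/
def IsExpandingOnRegions (g : Plane → Plane) {q : ℕ} (R : Fin q → Set Plane) : Prop :=
  ∃ lam : ℝ, 1 < lam ∧ ∀ x ∈ ⋃ i, R i, ∀ v : Plane, lam * ‖v‖ ≤ ‖fderiv ℝ g x v‖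

/-- `g : Ω → Ω` is piecewise-`C^r` and expanding (for the same finite family of regions). -/
def IsPiecewiseCrExpanding (r : ℕ∞) (g : Plane → Plane) (Ω : Set Plane) : Prop :=
  ∃ (q : ℕ) (R : Fin q → Set Plane), IsPiecewiseCrWith r g Ω R ∧ IsExpandingOnRegions g R

/-! Put both traces equal to zero. After the rescaling x = |μ|(z - (0,1)) with μ > 0, the truncated
map becomes (z₁, z₂) ↦ (z₂, T z₁), where T is a skew tent map with slopes -δ_L and -δ_R. Its second
iterate is T × T, so the planar dynamics is read off from that of T. With left slope 1/2 and a
suitable steep negative right slope, T cyclically permutes p = 2N disjoint intervals and T^p is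
expanding (`exists_cyclicBands`). Products of these intervals form p² rectangles, and rectangle (i,
k) goes into (k, i + 1). The difference d = i - k becomes -1 - d, an involution of ℤ/2N without
fixed points. Its N orbits give N disjoint trapping regions (`differenceClass`), on which the
iterate of order 2p is a diagonal expansion, piecewise.

This picture survives C¹-small perturbations. To make the inclusions strict, rectangles are taken as
larger interval times smaller interval (`NestedBands`). During 2p steps the orbit of a rectangle can
meet the switching line at two times only, so two nearly straight curves cut it into four quarters.
On each quarter the iterate is one composition of smooth pieces (`iterate_eq_wordIter`), and the
quarters have piecewise-C^r boundaries because a C¹-small change of coordinates straightens them to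
a square (`eventually_exists_quarter`). `eventually_isGood` gathers these facts for sequences;
arguing by contradiction gives one tolerance ε valid for all r (`exists_isGood_of_closeOn`).

The rescaled pieces are C¹-close to the zero-trace pieces on large balls, for small μ and for
parameters near the chosen ones (`exists_closeOn_rescaled`); this produces the open set U. For μ < 0
the rescaled left piece has an attracting fixed point inside the left half-plane, which persists
(`eventually_exists_stable`). Similarities transport all conclusions back. -/

section Families

/-! ### Local C¹ convergence of families of maps. -/

variable {Λ E E₁ E₂ : Type*} [NormedAddCommGroup E] [NormedSpace ℝ E]
  [NormedAddCommGroup E₁] [NormedSpace ℝ E₁] [NormedAddCommGroup E₂] [NormedSpace ℝ E₂]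

/-- The family of maps `F n` converges to `A` along `l` in the `C¹` topology near the point `x`, and
`F n` is of class `C^(r n)` near `x`. -/
structure C1TendstoAt (l : Filter Λ) (r : Λ → ℕ∞) (F : Λ → E → E₁) (A : E → E₁) (x : E) :
    Prop where
  contDiffAt : ∀ᶠ q in l ×ˢ 𝓝 x, ContDiffAt ℝ (r q.1) (F q.1) q.2
  tendsto : Tendsto (fun q : Λ × E => F q.1 q.2) (l ×ˢ 𝓝 x) (𝓝 (A x))
  tendsto_fderiv : Tendsto (fun q : Λ × E => fderiv ℝ (F q.1) q.2) (l ×ˢ 𝓝 x) (𝓝 (fderiv ℝ A x))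
  differentiableAt : DifferentiableAt ℝ A x

variable {l : Filter Λ} {r : Λ → ℕ∞}

theorem one_le_coe_enat {r : ℕ∞} (hr : 1 ≤ r) : (1 : WithTop ℕ∞) ≤ (r : WithTop ℕ∞) := by
  exact_mod_cast hr

theorem coe_enat_ne_zero {r : ℕ∞} (hr : 1 ≤ r) : (r : WithTop ℕ∞) ≠ 0 := by
  have := one_le_coe_enat hr
  intro h
  rw [h] at this
  exact absurd this (by simp)

/-- The limits are along `l ×ˢ 𝓝 x`, so base points may move together with the index; hence values,
and derivatives through the chain rule, can be substituted directly. -/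
theorem C1TendstoAt.comp (hr : ∀ n, 1 ≤ r n) {F : Λ → E → E₁} {A : E → E₁} {G : Λ → E₁ → E₂}
    {B : E₁ → E₂} {x : E} (hG : C1TendstoAt l r G B (A x)) (hF : C1TendstoAt l r F A x) :
    C1TendstoAt l r (fun n => G n ∘ F n) (B ∘ A) x := by
  have hmap : Tendsto (fun q : Λ × E => (q.1, F q.1 q.2)) (l ×ˢ 𝓝 x) (l ×ˢ 𝓝 (A x)) :=
    tendsto_fst.prodMk hF.tendsto
  refine ⟨?_, hG.tendsto.comp hmap, ?_, hG.differentiableAt.comp x hF.differentiableAt⟩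
  · filter_upwards [hF.contDiffAt, hmap.eventually hG.contDiffAt] with q h1 h2
    exact h2.comp q.2 h1
  · rw [fderiv_comp x hG.differentiableAt hF.differentiableAt]
    have h := (isBoundedBilinearMap_comp (𝕜 := ℝ) (E := E) (F := E₁) (G := E₂)).continuous.tendsto
      (fderiv ℝ B (A x), fderiv ℝ A x)
    refine (h.comp ((hG.tendsto_fderiv.comp hmap).prodMk_nhds hF.tendsto_fderiv)).congr' ?_
    filter_upwards [hF.contDiffAt, hmap.eventually hG.contDiffAt] with q h1 h2
    exact (fderiv_comp q.2 (h2.differentiableAt (coe_enat_ne_zero (hr _)))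
      (h1.differentiableAt (coe_enat_ne_zero (hr _)))).symm

theorem C1TendstoAt.prodMk (hr : ∀ n, 1 ≤ r n) {F : Λ → E → E₁} {A : E → E₁} {G : Λ → E → E₂}
    {B : E → E₂} {x : E} (hF : C1TendstoAt l r F A x) (hG : C1TendstoAt l r G B x) :
    C1TendstoAt l r (fun n z => (F n z, G n z)) (fun z => (A z, B z)) x := by
  refine ⟨?_, hF.tendsto.prodMk_nhds hG.tendsto, ?_, hF.differentiableAt.prodMk hG.differentiableAt⟩
  · filter_upwards [hF.contDiffAt, hG.contDiffAt] with q h1 h2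
    exact h1.prodMk h2
  · rw [hF.differentiableAt.fderiv_prodMk hG.differentiableAt]
    have h := (ContinuousLinearMap.prodₗᵢ (𝕜 := ℝ) (E := E) (F := E₁) (G := E₂) ℝ).continuous.tendsto
      (fderiv ℝ A x, fderiv ℝ B x)
    refine (h.comp (hF.tendsto_fderiv.prodMk_nhds hG.tendsto_fderiv)).congr' ?_
    filter_upwards [hF.contDiffAt, hG.contDiffAt] with q h1 h2
    exact ((h1.differentiableAt (coe_enat_ne_zero (hr _))).fderiv_prodMk
      (h2.differentiableAt (coe_enat_ne_zero (hr _)))).symm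

theorem C1TendstoAt.const {A : E → E₁} {x : E}
    (hA : ∀ᶠ y in 𝓝 x, ContDiffAt ℝ (⊤ : ℕ∞) A y) : C1TendstoAt l r (fun _ => A) A x := by
  have hx := hA.self_of_nhds
  have h1 : ((⊤ : ℕ∞) : WithTop ℕ∞) ≠ 0 := coe_enat_ne_zero le_top
  refine ⟨?_, hx.continuousAt.tendsto.comp tendsto_snd, ?_, hx.differentiableAt h1⟩
  · filter_upwards [tendsto_snd.eventually hA] with q h
    exact h.of_le (by exact_mod_cast le_top)
  · have : ContinuousAt (fderiv ℝ A) x := by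
      refine (hx.fderiv_right (m := 0) ?_).continuousAt
      simp
    exact this.tendsto.comp tendsto_snd

/-- A property that holds locally uniformly near every point of a compact set eventually holds on
the compact set. -/
theorem IsCompact.eventually_forall_of_prod {X : Type*} [TopologicalSpace X] {K : Set X}
    (hK : IsCompact K) {P : Λ → X → Prop}
    (h : ∀ x ∈ K, ∀ᶠ q in l ×ˢ 𝓝 x, P q.1 q.2) : ∀ᶠ n in l, ∀ x ∈ K, P n x := by
  refine hK.induction_on (p := fun s => ∀ᶠ n in l, ∀ x ∈ s, P n x) (by simp) ?_ ?_ ?_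
  · intro s t hst ht
    filter_upwards [ht] with n hn x hx using hn x (hst hx)
  · intro s t hs ht
    filter_upwards [hs, ht] with n h1 h2 x hx using hx.elim (h1 x) (h2 x)
  · intro x hx
    obtain ⟨pa, hpa, pb, hpb, H⟩ := eventually_prod_iff.1 (h x hx)
    refine ⟨{y | pb y}, mem_nhdsWithin_of_mem_nhds hpb, ?_⟩
    filter_upwards [hpa] with n hn y hy using H hn hy

end Families
-- The unit square and its images under near-affine diffeomorphisms.
section UnitSquare

/-- The closed unit square in the plane. -/
def closedUnitSquare : Set Plane := {w | ∀ i, w i ∈ Icc (0 : ℝ) 1}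

/-- The open unit square in the plane. -/
def openUnitSquare : Set Plane := {w | ∀ i, w i ∈ Ioo (0 : ℝ) 1}

theorem closedUnitSquare_eq_preimage :
    closedUnitSquare = PiLp.homeomorph 2 (fun _ : Fin 2 => ℝ) ⁻¹' (univ.pi fun _ => Icc 0 1) := by
  ext w; exact ⟨fun h i _ => h i, fun h i => h i trivial⟩

theorem openUnitSquare_eq_preimage :
    openUnitSquare = PiLp.homeomorph 2 (fun _ : Fin 2 => ℝ) ⁻¹' (univ.pi fun _ => Ioo 0 1) := by
  ext w; exact ⟨fun h i _ => h i, fun h i => h i trivial⟩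

theorem closure_openUnitSquare : closure openUnitSquare = closedUnitSquare := by
  rw [openUnitSquare_eq_preimage, closedUnitSquare_eq_preimage, ← Homeomorph.preimage_closure,
    closure_pi_set]
  simp [closure_Ioo]

theorem isOpen_openUnitSquare : IsOpen openUnitSquare := by
  rw [openUnitSquare_eq_preimage]
  exact (isOpen_set_pi finite_univ fun _ _ => isOpen_Ioo).preimage (Homeomorph.continuous _)

theorem isCompact_closedUnitSquare : IsCompact closedUnitSquare := by
  rw [closedUnitSquare_eq_preimage]
  exact (Homeomorph.isCompact_preimage _).2 (isCompact_univ_pi fun _ => isCompact_Icc)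

theorem openUnitSquare_subset : openUnitSquare ⊆ closedUnitSquare :=
  fun _ hw i => Ioo_subset_Icc_self (hw i)

theorem isConnected_openUnitSquare : IsConnected openUnitSquare := by
  refine ⟨⟨!₂[1 / 2, 1 / 2], fun i => by fin_cases i <;> norm_num⟩, Convex.isPreconnected ?_⟩
  intro x hx y hy a b ha hb hab i
  have := convex_Ioo (0 : ℝ) 1 (hx i) (hy i) ha hb hab
  simpa using this

/-- The four vertices of the unit square. -/
noncomputable def squareVertex : Fin 4 → Plane := ![!₂[0, 0], !₂[1, 0], !₂[1, 1], !₂[0, 1]]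

/-- The directions of the four sides of the unit square. -/
noncomputable def squareDir : Fin 4 → Plane := ![!₂[1, 0], !₂[0, 1], !₂[-1, 0], !₂[0, -1]]

/-- The sides of the unit square, parametrised counterclockwise by `[0, 1]`. -/
noncomputable def squareSide (j : Fin 4) (s : ℝ) : Plane := squareVertex j + s • squareDir j

theorem squareDir_ne_zero (j : Fin 4) : squareDir j ≠ 0 := by
  intro h
  have h0 := congrArg (fun v : Plane => v 0) h
  have h1 := congrArg (fun v : Plane => v 1) h
  fin_cases j <;> simp [squareDir] at h0 h1

theorem hasDerivAt_squareSide (j : Fin 4) (s : ℝ) :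
    HasDerivAt (squareSide j) (squareDir j) s := by
  have := ((hasDerivAt_id s).smul_const (squareDir j)).const_add (squareVertex j)
  rw [one_smul] at this
  exact this

theorem contDiff_squareSide {n : WithTop ℕ∞} (j : Fin 4) : ContDiff ℝ n (squareSide j) := by
  unfold squareSide; fun_prop

theorem squareSide_mem (j : Fin 4) {s : ℝ} (hs : s ∈ Icc (0 : ℝ) 1) :
    squareSide j s ∈ closedUnitSquare := by
  obtain ⟨h0, h1⟩ := hs
  intro i
  fin_cases j <;> fin_cases i <;> simp [squareSide, squareVertex, squareDir] <;>
    constructor <;> linarith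

theorem squareSide_one (j : Fin 4) : squareSide j 1 = squareSide (j + 1) 0 := by
  ext i
  fin_cases j <;> fin_cases i <;> simp [squareSide, squareVertex, squareDir]

theorem squareSide_injective {i j : Fin 4} {s t : ℝ} (hs : s ∈ Ico (0 : ℝ) 1)
    (ht : t ∈ Ico (0 : ℝ) 1) (h : squareSide i s = squareSide j t) : i = j ∧ s = t := by
  obtain ⟨hs0, hs1⟩ := hs
  obtain ⟨ht0, ht1⟩ := ht
  have h0 := congrArg (fun v : Plane => v 0) h
  have h1 := congrArg (fun v : Plane => v 1) h
  fin_cases i <;> fin_cases j <;> simp [squareSide, squareVertex, squareDir] at h0 h1 ⊢ <;>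
    linarith

theorem closedUnitSquare_diff :
    closedUnitSquare \ openUnitSquare = ⋃ j, squareSide j '' Icc 0 1 := by
  apply Subset.antisymm
  · rintro w ⟨hw, hn⟩
    have h0 := hw 0
    have h1 := hw 1
    have key : w 0 = 0 ∨ w 0 = 1 ∨ w 1 = 0 ∨ w 1 = 1 := by
      by_contra! hc
      obtain ⟨ha, hb, hc, hd⟩ := hc
      apply hn
      intro i
      fin_cases i
      · exact ⟨lt_of_le_of_ne h0.1 (Ne.symm ha), lt_of_le_of_ne h0.2 hb⟩
      · exact ⟨lt_of_le_of_ne h1.1 (Ne.symm hc), lt_of_le_of_ne h1.2 hd⟩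
    rw [mem_iUnion]
    rcases key with h | h | h | h
    · refine ⟨3, 1 - w 1, ⟨by linarith [h1.2], by linarith [h1.1]⟩, ?_⟩
      ext i; fin_cases i <;> simp [squareSide, squareVertex, squareDir, h]
    · refine ⟨1, w 1, h1, ?_⟩
      ext i; fin_cases i <;> simp [squareSide, squareVertex, squareDir, h]
    · refine ⟨0, w 0, h0, ?_⟩
      ext i; fin_cases i <;> simp [squareSide, squareVertex, squareDir, h]
    · refine ⟨2, 1 - w 0, ⟨by linarith [h0.2], by linarith [h0.1]⟩, ?_⟩
      ext i; fin_cases i <;> simp [squareSide, squareVertex, squareDir, h]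
  · rintro w hw
    obtain ⟨j, s, hs, rfl⟩ := mem_iUnion.1 hw
    refine ⟨squareSide_mem j hs, fun hn => ?_⟩
    have h0 := hn 0
    have h1 := hn 1
    fin_cases j <;> simp [squareSide, squareVertex, squareDir] at h0 h1

/-- The image of the open unit square under a local `C^r` diffeomorphism. -/
theorem OpenPartialHomeomorph.image_openUnitSquare {r : ℕ∞} (hr : 1 ≤ r)
    (φ : OpenPartialHomeomorph Plane Plane) (hK : closedUnitSquare ⊆ φ.target)
    (hφ : ∀ y ∈ closedUnitSquare, ContDiffAt ℝ r φ.symm y)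
    (hinj : ∀ y ∈ closedUnitSquare, ∀ v, fderiv ℝ φ.symm y v = 0 → v = 0) :
    IsOpen (φ.symm '' openUnitSquare) ∧ IsConnected (φ.symm '' openUnitSquare) ∧
      closure (φ.symm '' openUnitSquare) = φ.symm '' closedUnitSquare ∧
      HasPiecewiseCrBoundary r (φ.symm '' openUnitSquare) := by
  have hc : ContinuousOn φ.symm closedUnitSquare := φ.continuousOn_symm.mono hK
  have hO : IsOpen (φ.symm '' openUnitSquare) :=
    φ.symm.isOpen_image_of_subset_source isOpen_openUnitSquare (openUnitSquare_subset.trans hK)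
  have hcl : closure (φ.symm '' openUnitSquare) = φ.symm '' closedUnitSquare := by
    apply Subset.antisymm
    · exact closure_minimal (image_mono openUnitSquare_subset)
        (isCompact_closedUnitSquare.image_of_continuousOn hc).isClosed
    · rw [← closure_openUnitSquare] at hc ⊢
      exact hc.image_closure
  have hinjOn : InjOn φ.symm closedUnitSquare := φ.symm.injOn.mono hK
  refine ⟨hO, isConnected_openUnitSquare.image _ (hc.mono openUnitSquare_subset), hcl, 1,
    fun _ => ⋃ j, (φ.symm ∘ squareSide j) '' Icc 0 1, fun _ => ?_, ?_, ?_⟩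
  · refine ⟨3, fun j => φ.symm ∘ squareSide j, ?_, ?_, ?_, ?_, rfl⟩
    · intro j s hs
      exact ((hφ _ (squareSide_mem j hs)).comp s (contDiff_squareSide j).contDiffAt).contDiffWithinAt
    · intro j s hs h
      have hd := (hφ _ (squareSide_mem j hs)).differentiableAt (coe_enat_ne_zero hr)
      have h2 := hd.hasFDerivAt.comp_hasDerivWithinAt s
        (hasDerivAt_squareSide j s).hasDerivWithinAt (s := Icc (0 : ℝ) 1)
      rw [h2.derivWithin (uniqueDiffOn_Icc zero_lt_one s hs)] at h
      exact squareDir_ne_zero j (hinj _ (squareSide_mem j hs) _ h)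
    · intro j
      exact congrArg φ.symm (squareSide_one j)
    · intro i j s hs t ht h
      exact squareSide_injective hs ht (hinjOn (squareSide_mem i (Ico_subset_Icc_self hs))
        (squareSide_mem j (Ico_subset_Icc_self ht)) h)
  · intro i j hij
    exact absurd (Subsingleton.elim i j) hij
  · rw [hO.frontier_eq, hcl, ← hinjOn.image_sdiff_subset openUnitSquare_subset,
      closedUnitSquare_diff, image_iUnion, iUnion_const]
    simp only [image_comp]

variable {Λ : Type*} {l : Filter Λ} {r : Λ → ℕ∞}

/-- If `Ξ n` converges in `C¹` to an affine isomorphism `A` of the plane, then the preimages of the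
open unit square under `Ξ n` are eventually regions with a piecewise-`C^r` boundary. -/
theorem eventually_preimage_openUnitSquare (hr : ∀ n, 1 ≤ r n) {Ξ : Λ → Plane → Plane}
    {A : Plane → Plane} (L : Plane ≃L[ℝ] Plane) (hA : ∀ z, A z = L z + A 0)
    (hΞ : ∀ x, C1TendstoAt l r Ξ A x) :
    ∃ ρ₀ : ℝ, ∀ ρ ≥ ρ₀, ∀ᶠ n in l,
      IsOpen (Metric.ball 0 ρ ∩ Ξ n ⁻¹' openUnitSquare) ∧
      IsConnected (Metric.ball 0 ρ ∩ Ξ n ⁻¹' openUnitSquare) ∧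
      closure (Metric.ball 0 ρ ∩ Ξ n ⁻¹' openUnitSquare) =
        Metric.ball 0 ρ ∩ Ξ n ⁻¹' closedUnitSquare ∧
      HasPiecewiseCrBoundary (r n) (Metric.ball 0 ρ ∩ Ξ n ⁻¹' openUnitSquare) := by
  have hAf : ∀ z, HasFDerivAt A (L : Plane →L[ℝ] Plane) z := fun z => by
    have : A = fun z => L z + A 0 := funext hA
    rw [this]
    exact L.hasFDerivAt.add_const _
  have hcont : Continuous fun y : Plane => L.symm (y - A 0) := by fun_prop
  obtain ⟨ρ₁, hρ₁⟩ := (isCompact_closedUnitSquare.image hcont).isBounded.subset_ball 0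
  -- The margin 1 leaves room for unit balls about the preimages of the square under A.
  refine ⟨ρ₁ + 1, fun ρ hρ => ?_⟩
  have hN : 0 < ‖(L.symm : Plane →L[ℝ] Plane)‖₊ := by
    rw [nnnorm_pos]
    intro h
    have : L.symm (!₂[1, 0] : Plane) = 0 := by
      have := congrArg (fun T : Plane →L[ℝ] Plane => T !₂[1, 0]) h
      exact this
    have h2 := (map_eq_zero_iff L.symm L.symm.injective).1 this
    have := congrArg (fun v : Plane => v 0) h2
    simp at this
  -- Half of the threshold ‖L⁻¹‖⁻¹: `Ξ n` is then injective, and the image of a closed unit ball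
  -- contains a ball of radius ‖L⁻¹‖⁻¹ - c = c about the image of its centre, which is exactly the
  -- error allowed between `Ξ n` and A.
  set c : NNReal := ‖(L.symm : Plane →L[ℝ] Plane)‖₊⁻¹ / 2 with hcdef
  have hcpos : 0 < c := by positivity
  have hclt : c < ‖(L.symm : Plane →L[ℝ] Plane)‖₊⁻¹ := NNReal.half_lt_self (by positivity)
  have hev : ∀ᶠ n in l, ∀ z ∈ Metric.closedBall (0 : Plane) ρ, ContDiffAt ℝ (r n) (Ξ n) z ∧
      ‖fderiv ℝ (Ξ n) z - L‖ ≤ c ∧ (∃ e : Plane ≃L[ℝ] Plane, fderiv ℝ (Ξ n) z = e) ∧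
      ‖Ξ n z - A z‖ ≤ c := by
    refine (isCompact_closedBall 0 ρ).eventually_forall_of_prod fun x _ => ?_
    have h1 := (hΞ x).tendsto_fderiv
    rw [(hAf x).fderiv] at h1
    have h2 := (hΞ x).tendsto
    have h3 : Tendsto (fun q : Λ × Plane => A q.2) (l ×ˢ 𝓝 x) (𝓝 (A x)) :=
      (hAf x).continuousAt.tendsto.comp tendsto_snd
    have h4 := (h2.sub h3).norm
    have h5 := (h1.sub_const (L : Plane →L[ℝ] Plane)).norm
    rw [sub_self, norm_zero] at h4 h5
    filter_upwards [(hΞ x).contDiffAt, h1.eventually (ContinuousLinearEquiv.nhds L),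
      h4.eventually_le_const (u := (c : ℝ)) (NNReal.coe_pos.2 hcpos),
      h5.eventually_le_const (u := (c : ℝ)) (NNReal.coe_pos.2 hcpos)] with q a1 a2 a3 a4
    obtain ⟨e, he⟩ := a2
    exact ⟨a1, a4, ⟨e, he.symm⟩, a3⟩
  filter_upwards [hev] with n hn
  have hn' : ∀ z ∈ Metric.ball (0 : Plane) ρ, _ := fun z hz => hn z (Metric.ball_subset_closedBall hz)
  have hdiff : ∀ z ∈ Metric.ball (0 : Plane) ρ, DifferentiableAt ℝ (Ξ n) z := fun z hz =>
    (hn' z hz).1.differentiableAt (coe_enat_ne_zero (hr n))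
  have happ : ApproximatesLinearOn (Ξ n) (L : Plane →L[ℝ] Plane) (Metric.ball 0 ρ) c := by
    intro x hx y hy
    exact (convex_ball 0 ρ).norm_image_sub_le_of_norm_fderiv_le' hdiff
      (fun z hz => (hn' z hz).2.1) hy hx
  set φ := happ.toOpenPartialHomeomorph (Ξ n) (Metric.ball 0 ρ) (Or.inr hclt) Metric.isOpen_ball
  have hK : closedUnitSquare ⊆ φ.target := by
    intro y hy
    have hx : L.symm (y - A 0) ∈ Metric.ball 0 ρ₁ := hρ₁ (mem_image_of_mem _ hy)
    set x := L.symm (y - A 0) with hxdef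
    have hAx : A x = y := by
      rw [hA, hxdef]; simp
    have hsub : Metric.closedBall x 1 ⊆ Metric.ball 0 ρ := by
      intro z hz
      rw [mem_ball_zero_iff] at hx ⊢
      rw [mem_closedBall_iff_norm] at hz
      have := norm_add_le (z - x) x
      rw [sub_add_cancel] at this
      linarith
    have hs := happ.surjOn_closedBall_of_nonlinearRightInverse L.toNonlinearRightInverse
      zero_le_one hsub
    have hmem : y ∈ Metric.closedBall (Ξ n x)
        (((L.toNonlinearRightInverse.nnnorm : ℝ)⁻¹ - c) * 1) := by
      rw [mem_closedBall_iff_norm, norm_sub_rev, ← hAx]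
      have h1 := (hn x (Metric.ball_subset_closedBall
        (hsub (Metric.mem_closedBall_self zero_le_one)))).2.2.2
      have h2 : (L.toNonlinearRightInverse.nnnorm : ℝ)⁻¹ = 2 * c := by
        change ((‖(L.symm : Plane →L[ℝ] Plane)‖₊ : NNReal) : ℝ)⁻¹ = 2 * c
        rw [hcdef]; push_cast; ring
      rw [h2]
      linarith
    obtain ⟨z, hz, hzy⟩ := hs hmem
    exact ⟨z, hsub hz, hzy⟩
  have hmaps : ∀ y ∈ closedUnitSquare, φ.symm y ∈ Metric.ball 0 ρ := fun y hy =>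
    φ.map_target (hK hy)
  have hsymm : ∀ y ∈ closedUnitSquare, ContDiffAt ℝ (r n) φ.symm y ∧
      ∀ v, fderiv ℝ φ.symm y v = 0 → v = 0 := by
    intro y hy
    obtain ⟨h1, -, ⟨e, he⟩, -⟩ := hn' _ (hmaps y hy)
    have hd : HasFDerivAt φ (e : Plane →L[ℝ] Plane) (φ.symm y) := by
      rw [← he]; exact (hdiff _ (hmaps y hy)).hasFDerivAt
    refine ⟨φ.contDiffAt_symm (hK hy) hd h1, fun v hv => ?_⟩
    rw [(φ.hasFDerivAt_symm (hK hy) hd).fderiv] at hv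
    exact (map_eq_zero_iff e.symm e.symm.injective).1 hv
  have himg : ∀ S ⊆ closedUnitSquare, φ.symm '' S = Metric.ball 0 ρ ∩ Ξ n ⁻¹' S := by
    intro S hS
    rw [φ.symm_image_eq_source_inter_preimage (hS.trans hK)]
    rfl
  have := φ.image_openUnitSquare (hr n) hK (fun y hy => (hsymm y hy).1)
    (fun y hy => (hsymm y hy).2)
  rwa [himg _ openUnitSquare_subset, himg _ Subset.rfl] at this

end UnitSquare
-- Cyclically permuted intervals of a skew tent map.
section Bands

/-- The sign of the side of the switching manifold named by `s`. -/
def sideSign (s : Bool) : ℝ := if s then 1 else -1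

/-- A skew tent map `x ↦ 1 + c s * x`, with the slope `c false` on the left of `0` and `c true` on
its right, together with `p` disjoint intervals `[lo j, hi j]` that it permutes cyclically, all but
the `0`-th being on one side of `0`. -/
structure CyclicBands (p : ℕ) [NeZero p] where
  /-- slopes -/
  c : Bool → ℝ
  /-- left end points -/
  lo : ZMod p → ℝ
  /-- preimages of the turning point -/
  mid : ZMod p → ℝ
  /-- right end points -/
  hi : ZMod p → ℝ
  /-- the side of `0` on which an interval lies -/
  side : ZMod p → Bool
  /-- lower bound of the slopes of the `p`-th iterate -/
  α : ℝ
  one_lt : 1 < α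
  c_ne_zero : ∀ s, c s ≠ 0
  lo_lt : ∀ j, lo j < mid j
  lt_hi : ∀ j, mid j < hi j
  mid_zero : mid 0 = 0
  mid_succ : ∀ j, j ≠ 0 → 1 + c (side j) * mid j = mid (j + 1)
  sign : ∀ j, j ≠ 0 → ∀ x ∈ Icc (lo j) (hi j), 0 < sideSign (side j) * x
  maps : ∀ j, ∀ x ∈ Icc (lo j) (hi j), ∀ s, 0 ≤ sideSign s * x →
    1 + c s * x ∈ Ioo (lo (j + 1)) (hi (j + 1))
  disjoint : Pairwise fun i j => Disjoint (Icc (lo i) (hi i)) (Icc (lo j) (hi j))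
  expanding : ∀ s, α ≤ |∏ j, c (if j = 0 then s else side j)|

theorem val_neg_add_one {p : ℕ} [NeZero p] (hp : 2 ≤ p) {j : ZMod p} (hj : j ≠ 0) :
    (-j).val = (-(j + 1)).val + 1 := by
  have : Fact (1 < p) := ⟨hp⟩
  have h : (-(j + 1)) + 1 = -j := by ring
  rw [← h, ZMod.val_add_of_lt, ZMod.val_one]
  rw [ZMod.val_one]
  by_contra! hc
  have h1 := ZMod.val_lt (-(j + 1))
  have h2 : (-(j + 1)).val = p - 1 := by omega
  have h3 : (-(j + 1)) + 1 = 0 := by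
    rw [← ZMod.natCast_zmod_val (-(j + 1)), h2, Nat.cast_sub (by omega)]
    simp
  rw [h, neg_eq_zero] at h3
  exact hj h3

-- Here the index d counts the steps left before reaching the interval around 0. The left branch 1 +
-- x/2 has fixed point 2, so x = 2 - 2^d u turns it into a shift of d with u unchanged; all
-- intervals are given by u between y d and Y d, with u = 2 the preimage of the turning point. Only
-- d = P lies to the right of 0, where u is read off through the right branch. The choice q b = 2(1
-- + q/16) makes the slope round the cycle just exceed 1.
set_option maxHeartbeats 1000000 in
theorem exists_bands_nat (P : ℕ) (hP : 1 ≤ P) :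
    ∃ (q b : ℝ) (lo mid hi : ℕ → ℝ), q = (1 / 2) ^ (P - 1) ∧ 0 < q ∧ q ≤ 1 ∧ 0 < b ∧
      q * b = 2 * (1 + q / 16) ∧
      (∀ d ≤ P, lo d < mid d ∧ mid d < hi d) ∧ mid 0 = 0 ∧
      (∀ d, d + 1 < P → 1 + 1 / 2 * mid (d + 1) = mid d) ∧ (1 - b * mid P = mid (P - 1)) ∧
      (∀ d, 1 ≤ d → d < P → hi d < 0) ∧ 0 < lo P ∧
      (∀ d, d + 1 < P → ∀ x ∈ Icc (lo (d + 1)) (hi (d + 1)), 1 + 1 / 2 * x ∈ Ioo (lo d) (hi d)) ∧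
      (∀ x ∈ Icc (lo P) (hi P), 1 - b * x ∈ Ioo (lo (P - 1)) (hi (P - 1))) ∧
      (∀ x ∈ Icc (lo 0) (hi 0), (x ≤ 0 → 1 + 1 / 2 * x ∈ Ioo (lo P) (hi P)) ∧
        (0 ≤ x → 1 - b * x ∈ Ioo (lo P) (hi P))) ∧
      (∀ d d', d < d' → d' ≤ P → Disjoint (Icc (lo d) (hi d)) (Icc (lo d') (hi d'))) := by
  obtain ⟨q, hq⟩ : ∃ q : ℝ, q = (1 / 2) ^ (P - 1) := ⟨_, rfl⟩
  have hq0 : 0 < q := by rw [hq]; positivity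
  have hq1 : q ≤ 1 := by rw [hq]; exact pow_le_one₀ (by norm_num) (by norm_num)
  have hqinv : (2 : ℝ) ^ (P - 1) = 1 / q := by rw [hq]; simp
  obtain ⟨b, hb⟩ : ∃ b : ℝ, b = 2 * (1 + q / 16) / q := ⟨_, rfl⟩
  have hb0 : 0 < b := by rw [hb]; positivity
  have hqb : q * b = 2 * (1 + q / 16) := by rw [hb]; field_simp
  -- Each interval must land strictly inside the next, so the u-range shrinks by θ at both ends per
  -- unit of d; the total loss q²/128 is small against the slack q²/8 and q²/64 below.
  obtain ⟨θ, hθ⟩ : ∃ θ : ℝ, θ = q ^ 2 / (128 * P) := ⟨_, rfl⟩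
  have hP0 : (0 : ℝ) < P := by exact_mod_cast hP
  have hθ0 : 0 < θ := by rw [hθ]; positivity
  have hPθ : P * θ = q ^ 2 / 128 := by rw [hθ]; field_simp
  obtain ⟨y, hy⟩ : ∃ y : ℕ → ℝ, ∀ d, y d = 2 - q ^ 2 / 8 + d * θ := ⟨_, fun _ => rfl⟩
  obtain ⟨Y, hY⟩ : ∃ Y : ℕ → ℝ, ∀ d, Y d = q + 2 * (1 + q / 16) + q ^ 2 / 64 - d * θ :=
    ⟨_, fun _ => rfl⟩
  have hdθ : ∀ d ≤ P, 0 ≤ d * θ ∧ d * θ ≤ q ^ 2 / 128 := fun d hd => by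
    refine ⟨by positivity, ?_⟩
    rw [← hPθ]
    have : (d : ℝ) ≤ P := by exact_mod_cast hd
    exact mul_le_mul_of_nonneg_right this hθ0.le
  have hq2 : 0 < q ^ 2 := by positivity
  have hq21 : q ^ 2 ≤ q := by nlinarith
  have hy_lt : ∀ d ≤ P, y d < 2 := fun d hd => by
    rw [hy]; linarith [hdθ d hd]
  have hlt_Y : ∀ d ≤ P, 2 < Y d := fun d hd => by
    rw [hY]; linarith [hdθ d hd]
  have hy_gt : ∀ d ≤ P, 15 / 8 ≤ y d := fun d hd => by
    rw [hy]; linarith [hdθ d hd]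
  have hY_lt : ∀ d ≤ P, Y d < 15 / 4 := fun d hd => by
    rw [hY]; linarith [hdθ d hd]
  have hy_mono : ∀ d, y d < y (d + 1) := fun d => by
    rw [hy, hy]; push_cast; linarith
  have hY_mono : ∀ d, Y (d + 1) < Y d := fun d => by
    rw [hY, hY]; push_cast; linarith
  obtain ⟨lo, hlo⟩ : ∃ lo : ℕ → ℝ,
      ∀ d, lo d = if d = P then (y d / q - 1) / b else 2 - 2 ^ d * Y d := ⟨_, fun _ => rfl⟩
  -- For d = P the formula solves 1 - b x = 2 - u/q, since 2^(P-1) = 1/q.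
  obtain ⟨mid, hmid⟩ : ∃ mid : ℕ → ℝ,
      ∀ d, mid d = if d = P then (2 / q - 1) / b else 2 - 2 ^ d * 2 := ⟨_, fun _ => rfl⟩
  obtain ⟨hi, hhi⟩ : ∃ hi : ℕ → ℝ,
      ∀ d, hi d = if d = P then (Y d / q - 1) / b else 2 - 2 ^ d * y d := ⟨_, fun _ => rfl⟩
  have hloP : lo P = (y P / q - 1) / b := by rw [hlo, if_pos rfl]
  have hmidP : mid P = (2 / q - 1) / b := by rw [hmid, if_pos rfl]
  have hhiP : hi P = (Y P / q - 1) / b := by rw [hhi, if_pos rfl]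
  have hlo' : ∀ d < P, lo d = 2 - 2 ^ d * Y d := fun d hd => by rw [hlo, if_neg hd.ne]
  have hmid' : ∀ d < P, mid d = 2 - 2 ^ d * 2 := fun d hd => by rw [hmid, if_neg hd.ne]
  have hhi' : ∀ d < P, hi d = 2 - 2 ^ d * y d := fun d hd => by rw [hhi, if_neg hd.ne]
  have hloP_eq : lo P = (y P - q) / (2 * (1 + q / 16)) := by
    rw [hloP, ← hqb]; field_simp
  have hloP_gt : q ^ 2 / 8 < lo P := by
    rw [hloP_eq, lt_div_iff₀ (by positivity)]
    have := hy_gt P le_rfl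
    nlinarith
  have hneg : ∀ d, 1 ≤ d → d < P → hi d < 0 := fun d h1 hd => by
    rw [hhi' d hd]
    have h2 := hy_gt d hd.le
    have h3 : (2 : ℝ) ≤ 2 ^ d := by simpa using pow_le_pow_right₀ (one_le_two (α := ℝ)) h1
    nlinarith
  have hmemP : ∀ x, y P < q * (1 + b * x) → q * (1 + b * x) < Y P → x ∈ Ioo (lo P) (hi P) := by
    intro x h1 h2
    rw [hloP, hhiP]
    constructor
    · rw [div_lt_iff₀ hb0, sub_lt_iff_lt_add, div_lt_iff₀ hq0]; linarith
    · rw [lt_div_iff₀ hb0, lt_sub_iff_add_lt, lt_div_iff₀ hq0]; linarith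
  refine ⟨q, b, lo, mid, hi, hq, hq0, hq1, hb0, hqb, ?_, ?_, ?_, ?_, hneg, by linarith, ?_, ?_, ?_, ?_⟩
  · intro d hd
    rcases hd.lt_or_eq with h | rfl
    · rw [hlo' d h, hmid' d h, hhi' d h]
      have := hy_lt d hd
      have := hlt_Y d hd
      have h2 : (0 : ℝ) < 2 ^ d := by positivity
      constructor <;> nlinarith
    · rw [hloP, hmidP, hhiP]
      have := hy_lt d hd
      have := hlt_Y d hd
      constructor <;> gcongr
  · rw [hmid' 0 (by omega)]; norm_num
  · intro d hd
    rw [hmid' _ hd, hmid' d (by omega), pow_succ]; ring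
  · rw [hmidP, hmid' _ (by omega), hqinv]; field_simp; ring
  · intro d hd x hx
    rw [hlo' _ hd, hhi' _ hd, pow_succ] at hx
    rw [hlo' d (by omega), hhi' d (by omega)]
    have := hy_mono d
    have := hY_mono d
    have h2 : (0 : ℝ) < 2 ^ d := by positivity
    obtain ⟨hx1, hx2⟩ := hx
    constructor <;> nlinarith
  · intro x hx
    rw [hloP, hhiP, mem_Icc, div_le_iff₀ hb0, le_div_iff₀ hb0] at hx
    rw [hlo' _ (by omega), hhi' _ (by omega), hqinv]
    have h1 := hy_mono (P - 1)
    have h2 := hY_mono (P - 1)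
    rw [Nat.sub_add_cancel hP] at h1 h2
    have h3 := div_lt_div_of_pos_right h1 hq0
    have h4 := div_lt_div_of_pos_right h2 hq0
    obtain ⟨hx1, hx2⟩ := hx
    rw [mem_Ioo, one_div_mul_eq_div, one_div_mul_eq_div]
    constructor <;> linarith
  · intro x hx
    rw [hlo' 0 (by omega), hhi' 0 (by omega), hy, hY] at hx
    simp only [pow_zero, one_mul, Nat.cast_zero, zero_mul] at hx
    obtain ⟨hx1, hx2⟩ := hx
    have h1 := hdθ P le_rfl
    -- An image x has coordinate u = q(1 + b x) in the interval P. The largest value is that of the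
    -- turning point, 2 + 9q/8, below Y P; on both branches the other end of the image stays above y
    -- P.
    refine ⟨fun hx0 => hmemP _ ?_ ?_, fun hx0 => hmemP _ ?_ ?_⟩
    · have : q * (1 + b * (1 + 1 / 2 * x)) = q + 2 * (1 + q / 16) * (1 + 1 / 2 * x) := by
        rw [← hqb]; ring
      rw [this, hy]
      have h2 : 1 - (9 / 8 * q + q ^ 2 / 64) / 2 ≤ 1 + 1 / 2 * x := by linarith
      have h3 := mul_le_mul_of_nonneg_left h2 (show 0 ≤ 2 * (1 + q / 16) by positivity)
      have h4 : q ^ 3 ≤ q ^ 2 := pow_le_pow_of_le_one hq0.le hq1 (by norm_num)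
      linarith
    · have : q * (1 + b * (1 + 1 / 2 * x)) = q + 2 * (1 + q / 16) * (1 + 1 / 2 * x) := by
        rw [← hqb]; ring
      rw [this, hY]
      have h2 : 1 + 1 / 2 * x ≤ 1 := by linarith
      have h3 := mul_le_mul_of_nonneg_left h2 (show 0 ≤ 2 * (1 + q / 16) by positivity)
      linarith
    · have : q * (1 + b * (1 - b * x)) =
          q + 2 * (1 + q / 16) - (2 * (1 + q / 16)) ^ 2 * x / q := by
        rw [← hqb]; field_simp; ring
      rw [this, hy]
      have h3 : (2 * (1 + q / 16)) ^ 2 * x / q ≤ q := by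
        rw [div_le_iff₀ hq0]
        have h4 : (2 * (1 + q / 16)) ^ 2 ≤ 8 := by nlinarith
        have h5 : x ≤ q ^ 2 / 8 := by linarith
        have h6 := mul_le_mul h4 h5 hx0 (by norm_num)
        linarith
      linarith
    · have : q * (1 + b * (1 - b * x)) =
          q + 2 * (1 + q / 16) - (2 * (1 + q / 16)) ^ 2 * x / q := by
        rw [← hqb]; field_simp; ring
      rw [this, hY]
      have h3 : 0 ≤ (2 * (1 + q / 16)) ^ 2 * x / q := by positivity
      linarith
  · intro d d' hdd hd'
    rw [disjoint_left]
    rintro x ⟨hx1, hx2⟩ ⟨hx3, hx4⟩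
    rcases hd'.lt_or_eq with h | rfl
    · rw [hlo' d (by omega)] at hx1
      rw [hhi' d' h] at hx4
      have h1 := hy_gt d' hd'
      have h2 := hY_lt d (by omega)
      have h3 : (2 : ℝ) ^ (d + 1) ≤ 2 ^ d' := pow_le_pow_right₀ one_le_two hdd
      rw [pow_succ] at h3
      have h4 : (0 : ℝ) < 2 ^ d := by positivity
      have h5 := mul_le_mul h3 h1 (by norm_num) (by positivity)
      have h6 := mul_lt_mul_of_pos_left h2 h4
      linarith
    · rcases Nat.eq_zero_or_pos d with rfl | h0
      · rw [hhi' 0 hdd, hy] at hx2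
        simp at hx2
        linarith
      · linarith [hneg d h0 hdd]

/-- Reindex by d = (-j).val, so that j ↦ j + 1 lowers d and j = 1 is the only interval wholly on the
right. The slope round the cycle is (1/2)^(p-2) · (-b) · c s; its modulus is 1 + q/16 for the left
letter and larger for the right one. -/
theorem exists_cyclicBands (p : ℕ) [NeZero p] (hp : 2 ≤ p) :
    ∃ B : CyclicBands p, B.c false = 1 / 2 := by
  have : Fact (1 < p) := ⟨hp⟩
  obtain ⟨q, b, lo, mid, hi, hq, hq0, hq1, hb0, hqb, hord, hmid0, hmidS, hmidP, hneg, hpos, hm1, hm2,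
    hm3, hdisj⟩ := exists_bands_nat (p - 1) (by omega)
  have hval : ∀ j : ZMod p, (-j).val ≤ p - 1 := fun j => by
    have := ZMod.val_lt (-j); omega
  have hone : (1 : ZMod p) ≠ 0 := one_ne_zero
  have hval1 : ∀ j : ZMod p, (-j).val = p - 1 ↔ j = 1 := fun j => by
    have h1 : (-(1 : ZMod p)).val = p - 1 := by
      obtain ⟨k, rfl⟩ : ∃ k, p = k + 1 := ⟨p - 1, by omega⟩
      rw [ZMod.val_neg_one]; rfl
    rw [← h1]
    exact ⟨fun h => neg_injective (ZMod.val_injective p h), fun h => by rw [h]⟩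
  have hval0 : ∀ j : ZMod p, j ≠ 0 → 1 ≤ (-j).val := fun j hj => by
    have := val_neg_add_one hp hj; omega
  have hb1 : 2 < b := by nlinarith
  set c : Bool → ℝ := fun s => if s then -b else 1 / 2 with hc
  have hsucc := fun (j : ZMod p) (hj : j ≠ 0) => val_neg_add_one hp hj
  refine ⟨{ c := c
            lo := fun j => lo (-j).val
            mid := fun j => mid (-j).val
            hi := fun j => hi (-j).val
            side := fun j => decide (j = 1)
            α := 1 + q / 16
            one_lt := by linarith
            c_ne_zero := ?_
            lo_lt := fun j => (hord _ (hval j)).1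
            lt_hi := fun j => (hord _ (hval j)).2
            mid_zero := by simpa using hmid0
            mid_succ := ?_
            sign := ?_
            maps := ?_
            disjoint := ?_
            expanding := ?_ }, rfl⟩
  · intro s
    cases s <;> simp [hc, hb0.ne']
  · intro j hj
    by_cases h1 : j = 1
    · have h2 := (hval1 j).2 h1
      have h3 := hsucc j hj
      have h4 : (-(j + 1)).val = p - 1 - 1 := by omega
      simp only [h1, decide_true, hc, if_true]
      rw [h1] at h2 h4
      rw [h2, h4, ← hmidP]; ring
    · have h2 : (-j).val ≠ p - 1 := fun h => h1 ((hval1 j).1 h)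
      have h3 := hsucc j hj
      have h4 := hval j
      have := hmidS (-(j + 1)).val (by omega)
      simp only [h1, hc, decide_false, Bool.false_eq_true, if_false]
      rw [h3, ← this]
  · intro j hj x hx
    by_cases h1 : j = 1
    · have h2 := (hval1 j).2 h1
      simp only [h1, decide_true, sideSign, if_true, one_mul]
      rw [h2] at hx
      linarith [hx.1]
    · have h2 : (-j).val ≠ p - 1 := fun h => h1 ((hval1 j).1 h)
      have h4 := hval j
      have := hneg _ (hval0 j hj) (by omega)
      simp [h1, sideSign]
      linarith [hx.2]
  · intro j x hx s hs
    by_cases hj : j = 0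
    · subst hj
      have h2 := (hval1 (0 + 1)).2 (zero_add 1)
      simp only [h2]
      simp only [neg_zero, ZMod.val_zero] at hx
      cases s
      · have := (hm3 x hx).1 (by simp [sideSign] at hs; linarith)
        simpa [hc] using this
      · have := (hm3 x hx).2 (by simpa [sideSign] using hs)
        simpa [hc, sub_eq_add_neg] using this
    · by_cases h1 : j = 1
      · have h2 := (hval1 j).2 h1
        have h3 := hsucc j hj
        have h4 : (-(j + 1)).val = p - 1 - 1 := by omega
        simp only [h4]
        rw [h2] at hx
        cases s
        · simp [sideSign] at hs
          linarith [hx.1]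
        · simpa [hc, sub_eq_add_neg] using hm2 x hx
      · have h2 : (-j).val ≠ p - 1 := fun h => h1 ((hval1 j).1 h)
        have h3 := hsucc j hj
        have h4 := hval j
        cases s
        · rw [h3] at hx
          simpa [hc] using hm1 _ (by omega) x hx
        · simp [sideSign] at hs
          linarith [hneg _ (hval0 j hj) (by omega), hx.2]
  · intro i j hij
    have hne : (-i).val ≠ (-j).val := fun h => hij (neg_injective (ZMod.val_injective p h))
    rcases lt_or_gt_of_ne hne with h | h
    · exact hdisj _ _ h (hval j)
    · exact (hdisj _ _ h (hval i)).symm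
  · intro s
    rw [← Finset.mul_prod_erase _ _ (Finset.mem_univ (0 : ZMod p)),
      ← Finset.mul_prod_erase _ _ (Finset.mem_erase.2 ⟨hone, Finset.mem_univ (1 : ZMod p)⟩),
      Finset.prod_congr (g := fun _ => (1 / 2 : ℝ)) rfl, Finset.prod_const,
      Finset.card_erase_of_mem (Finset.mem_erase.2 ⟨hone, Finset.mem_univ (1 : ZMod p)⟩),
      Finset.card_erase_of_mem (Finset.mem_univ _), Finset.card_univ, ZMod.card, ← hq]
    · simp only [if_true, hone, if_false, decide_true, abs_mul]
      have h1 : |c true| = b := by simp [hc, abs_of_pos hb0]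
      have h2 : 1 / 2 ≤ |c s| := by
        cases s
        · simp [hc, abs_of_pos]
        · rw [h1]; linarith
      rw [h1, abs_of_pos hq0, mul_comm b q, hqb]
      nlinarith
    · intro j hj
      have h1 := (Finset.mem_erase.1 hj).1
      have h0 := (Finset.mem_erase.1 (Finset.mem_erase.1 hj).2).1
      simp [h0, h1, hc]

/-- Cyclic bands together with smaller intervals `[lo' j, hi' j]`, in the interior of the intervals
`[lo j, hi j]`, that already contain the images of the latter. -/
structure NestedBands (p : ℕ) [NeZero p] extends CyclicBands p where
  /-- left end points of the smaller intervals -/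
  lo' : ZMod p → ℝ
  /-- right end points of the smaller intervals -/
  hi' : ZMod p → ℝ
  lo_lt_lo' : ∀ j, lo j < lo' j
  lo'_lt : ∀ j, lo' j < mid j
  lt_hi' : ∀ j, mid j < hi' j
  hi'_lt_hi : ∀ j, hi' j < hi j
  maps' : ∀ j, ∀ x ∈ Icc (lo j) (hi j), ∀ s, 0 ≤ sideSign s * x →
    1 + c s * x ∈ Ioo (lo' (j + 1)) (hi' (j + 1))

theorem IsCompact.exists_subset_Ioo_of_subset_Ioo {K : Set ℝ} (hK : IsCompact K) {a b m : ℝ}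
    (h : K ⊆ Ioo a b) (hm : m ∈ Ioo a b) :
    ∃ a' b', a < a' ∧ a' < m ∧ m < b' ∧ b' < b ∧ K ⊆ Ioo a' b' := by
  have hK' : IsCompact (insert m K) := hK.insert m
  have h' : insert m K ⊆ Ioo a b := insert_subset hm h
  obtain ⟨u, hu, hul⟩ := hK'.exists_isLeast (insert_nonempty _ _)
  obtain ⟨v, hv, hvl⟩ := hK'.exists_isGreatest (insert_nonempty _ _)
  obtain ⟨a', h1, h2⟩ := exists_between (h' hu).1
  obtain ⟨b', h3, h4⟩ := exists_between (h' hv).2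
  exact ⟨a', b', h1, h2.trans_le (hul (mem_insert _ _)), (hvl (mem_insert _ _)).trans_lt h3, h4,
    fun x hx => ⟨h2.trans_le (hul (mem_insert_of_mem _ hx)),
      (hvl (mem_insert_of_mem _ hx)).trans_lt h3⟩⟩

/-- The image of an interval, over both closed halves, is compact in an open interval, so a smaller
interval fits in between. -/
theorem CyclicBands.exists_nestedBands {p : ℕ} [NeZero p] (B : CyclicBands p) :
    ∃ B' : NestedBands p, B'.toCyclicBands = B := by
  have key : ∀ j, ∃ a b, B.lo j < a ∧ a < B.mid j ∧ B.mid j < b ∧ b < B.hi j ∧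
      (⋃ s, (fun x => 1 + B.c s * x) ''
        (Icc (B.lo (j - 1)) (B.hi (j - 1)) ∩ {x | 0 ≤ sideSign s * x})) ⊆ Ioo a b := by
    intro j
    refine IsCompact.exists_subset_Ioo_of_subset_Ioo ?_ ?_ ⟨B.lo_lt j, B.lt_hi j⟩
    · refine isCompact_iUnion fun s => IsCompact.image ?_ (by fun_prop)
      exact isCompact_Icc.inter_right (isClosed_le continuous_const (by fun_prop))
    · refine iUnion_subset fun s => ?_
      rintro _ ⟨x, ⟨hx, hs⟩, rfl⟩
      simpa using B.maps (j - 1) x hx s hs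
  choose a b h1 h2 h3 h4 h5 using key
  refine ⟨{ B with
    lo' := a
    hi' := b
    lo_lt_lo' := h1
    lo'_lt := h2
    lt_hi' := h3
    hi'_lt_hi := h4
    maps' := fun j x hx s hs => h5 (j + 1) (mem_iUnion.2 ⟨s, x, ⟨?_, hs⟩, rfl⟩) }, rfl⟩
  simpa using hx

end Bands
-- Compositions along a word of smooth pieces.
section Words

/-- A piece of the product form `(x, y) ↦ (y, 1 + c s * x)`. -/
noncomputable def tentPiece (c : Bool → ℝ) (s : Bool) (z : Plane) : Plane :=
  !₂[z 1, 1 + c s * z 0]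

/-- The composition of the maps named by the first letters of the word `s`. -/
def wordIter {X : Type*} (F : Bool → X → X) (s : ℕ → Bool) : ℕ → X → X
  | 0 => id
  | t + 1 => F (s t) ∘ wordIter F s t

theorem affine_wordIter (c : Bool → ℝ) (s : ℕ → Bool) (t : ℕ) (x y : ℝ) :
    wordIter (fun a u => 1 + c a * u) s t x =
      wordIter (fun a u => 1 + c a * u) s t y + (∏ j ∈ Finset.range t, c (s j)) * (x - y) := by
  induction t with
  | zero => simp [wordIter]
  | succ t ih =>
    simp only [wordIter, Function.comp_apply]
    rw [ih, Finset.prod_range_succ]; ring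

/-- Each step swaps the coordinates and applies a branch to one of them. The two coordinates
therefore evolve independently, the first using the letters at even positions and the second those
at odd positions. -/
theorem tentPiece_wordIter (c : Bool → ℝ) (s : ℕ → Bool) (t : ℕ) (z : Plane) :
    wordIter (tentPiece c) s (2 * t) z =
      !₂[wordIter (fun a u => 1 + c a * u) (fun j => s (2 * j)) t (z 0),
        wordIter (fun a u => 1 + c a * u) (fun j => s (2 * j + 1)) t (z 1)] ∧
    wordIter (tentPiece c) s (2 * t + 1) z =
      !₂[wordIter (fun a u => 1 + c a * u) (fun j => s (2 * j + 1)) t (z 1),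
        wordIter (fun a u => 1 + c a * u) (fun j => s (2 * j)) (t + 1) (z 0)] := by
  induction t with
  | zero =>
    constructor
    · ext i; fin_cases i <;> simp [wordIter]
    · ext i; fin_cases i <;> simp [wordIter, tentPiece]
  | succ t ih =>
    have h1 : wordIter (tentPiece c) s (2 * (t + 1)) z =
      !₂[wordIter (fun a u => 1 + c a * u) (fun j => s (2 * j)) (t + 1) (z 0),
        wordIter (fun a u => 1 + c a * u) (fun j => s (2 * j + 1)) (t + 1) (z 1)] := by
      rw [show 2 * (t + 1) = (2 * t + 1) + 1 by ring, wordIter, Function.comp_apply, ih.2]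
      ext i; fin_cases i <;> simp [wordIter, tentPiece]
    refine ⟨h1, ?_⟩
    rw [wordIter, Function.comp_apply, h1]
    ext i; fin_cases i <;> simp [wordIter, tentPiece]

/-- The invertible linear map of the plane with diagonal matrix `diag(a, b)`. -/
noncomputable def diagEquiv (a b : ℝ) (ha : a ≠ 0) (hb : b ≠ 0) : Plane ≃L[ℝ] Plane :=
  LinearEquiv.toContinuousLinearEquiv
    { toFun := fun z => !₂[a * z 0, b * z 1]
      map_add' := fun x y => by ext i; fin_cases i <;> simp <;> ring
      map_smul' := fun k x => by ext i; fin_cases i <;> simp <;> ring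
      invFun := fun z => !₂[z 0 / a, z 1 / b]
      left_inv := fun z => by ext i; fin_cases i <;> simp [ha, hb]
      right_inv := fun z => by ext i; fin_cases i <;> simp <;> field_simp }

theorem diagEquiv_apply {a b : ℝ} (ha : a ≠ 0) (hb : b ≠ 0) (z : Plane) :
    diagEquiv a b ha hb z = !₂[a * z 0, b * z 1] := rfl

theorem le_norm_diagEquiv {a b k : ℝ} (ha : a ≠ 0) (hb : b ≠ 0) (hk : 0 ≤ k) (hka : k ≤ |a|)
    (hkb : k ≤ |b|) (z : Plane) : k * ‖z‖ ≤ ‖diagEquiv a b ha hb z‖ := by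
  refine le_of_sq_le_sq ?_ (norm_nonneg _)
  rw [mul_pow, EuclideanSpace.norm_sq_eq, EuclideanSpace.norm_sq_eq, diagEquiv_apply]
  simp only [Fin.sum_univ_two, Real.norm_eq_abs, sq_abs]
  have h1 : k ^ 2 ≤ a ^ 2 := by rw [← sq_abs a]; gcongr
  have h2 : k ^ 2 ≤ b ^ 2 := by rw [← sq_abs b]; gcongr
  have h3 := mul_le_mul_of_nonneg_right h1 (sq_nonneg (z 0))
  have h4 := mul_le_mul_of_nonneg_right h2 (sq_nonneg (z 1))
  simp
  linarith

end Words

/-! ### Quarters of rectangles cut by nearly straight curves. -/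

section Regions

variable {Λ : Type*} {l : Filter Λ} {r : Λ → ℕ∞}

/-- The ratio is 0 on the curve `G n z` = 0 and 1 on the line `z i` = β, so it straightens the strip
between them. Its denominator tends to the nonzero constant κ(β - c), which makes the limit affine.
-/
theorem sideRatio_c1TendstoAt (hr : ∀ n, 1 ≤ r n) {G : Λ → Plane → ℝ} {κ c β : ℝ} (i : Fin 2)
    (hκ : κ ≠ 0) (hβ : β ≠ c) {x : Plane} (hG : C1TendstoAt l r G (fun z => κ * (z i - c)) x) :
    C1TendstoAt l r (fun n z => G n z / (G n z + κ * (β - z i))) (fun z => (z i - c) / (β - c))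
      x := by
  have hid : C1TendstoAt l r (fun _ => (id : Plane → Plane)) id x :=
    C1TendstoAt.const (Eventually.of_forall fun _ => contDiffAt_id)
  have hden : κ * (β - c) ≠ 0 := mul_ne_zero hκ (sub_ne_zero.2 hβ)
  have hφ : C1TendstoAt l r (fun _ => fun q : ℝ × Plane => q.1 / (q.1 + κ * (β - q.2 i)))
      (fun q : ℝ × Plane => q.1 / (q.1 + κ * (β - q.2 i))) (κ * (x i - c), x) := by
    apply C1TendstoAt.const
    have hcont : Continuous fun q : ℝ × Plane => q.1 + κ * (β - q.2 i) := by fun_prop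
    have hne : ∀ᶠ q in 𝓝 ((κ * (x i - c), x) : ℝ × Plane), q.1 + κ * (β - q.2 i) ≠ 0 := by
      refine hcont.continuousAt.eventually_ne ?_
      convert hden using 1
      ring
    filter_upwards [hne] with q hq
    exact contDiffAt_fst.div (by fun_prop) hq
  have := C1TendstoAt.comp (A := fun z : Plane => (κ * (z i - c), id z)) hr hφ (hG.prodMk hr hid)
  have hlim : (fun z : Plane => (z i - c) / (β - c)) =
      (fun q : ℝ × Plane => q.1 / (q.1 + κ * (β - q.2 i))) ∘
        fun z : Plane => (κ * (z i - c), id z) := by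
    funext z
    simp only [Function.comp_apply, id]
    rw [show κ * (z i - c) + κ * (β - z i) = κ * (β - c) by ring, mul_div_mul_left _ _ hκ]
  rw [hlim]
  exact this

/-- The right or left end point `hi` or `lo`, according to the sign of `κ`. -/
noncomputable def farEnd (κ lo hi : ℝ) : ℝ := if 0 < κ then hi else lo

theorem farEnd_ne {κ lo c hi : ℝ} (h1 : lo < c) (h2 : c < hi) : farEnd κ lo hi ≠ c := by
  unfold farEnd; split_ifs
  · exact h2.ne'
  · exact h1.ne

theorem mul_farEnd_sub_pos {κ lo c hi : ℝ} (hκ : κ ≠ 0) (h1 : lo < c) (h2 : c < hi) :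
    0 < κ * (farEnd κ lo hi - c) := by
  unfold farEnd; split_ifs with h
  · exact mul_pos h (by linarith)
  · exact mul_pos_of_neg_of_neg (lt_of_le_of_ne (not_lt.1 h) hκ) (by linarith)

theorem mul_farEnd_sub_nonneg {κ lo x hi : ℝ} (hx : x ∈ Icc lo hi) :
    0 ≤ κ * (farEnd κ lo hi - x) := by
  unfold farEnd; split_ifs with h
  · exact mul_nonneg h.le (by linarith [hx.2])
  · exact mul_nonneg_of_nonpos_of_nonpos (not_lt.1 h) (by linarith [hx.1])

/-- On a compact set, the inequalities `0 ≤ G n z` and `0 ≤ κ * (farEnd κ lo hi - z i)` eventually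
force `z i` to lie between `lo` and `hi`. -/
theorem eventually_mem_Icc_of_side {G : Λ → Plane → ℝ} {κ lo c hi : ℝ} (i : Fin 2)
    (hκ : κ ≠ 0) (h1 : lo < c) (h2 : c < hi)
    (hG : ∀ x, C1TendstoAt l r G (fun z => κ * (z i - c)) x) {K : Set Plane} (hK : IsCompact K) :
    ∀ᶠ n in l, ∀ z ∈ K, 0 < G n z + κ * (farEnd κ lo hi - z i) ∧
      (0 ≤ G n z → 0 ≤ κ * (farEnd κ lo hi - z i) → z i ∈ Icc lo hi) := by
  refine hK.eventually_forall_of_prod fun x _ => ?_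
  have hco : Tendsto (fun q : Λ × Plane => q.2 i) (l ×ˢ 𝓝 x) (𝓝 (x i)) :=
    ((by fun_prop : Continuous fun z : Plane => z i).tendsto x).comp tendsto_snd
  have hden : Tendsto (fun q : Λ × Plane => G q.1 q.2 + κ * (farEnd κ lo hi - q.2 i)) (l ×ˢ 𝓝 x)
      (𝓝 (κ * (x i - c) + κ * (farEnd κ lo hi - x i))) :=
    (hG x).tendsto.add ((hco.const_sub _).const_mul _)
  have hpos := mul_farEnd_sub_pos hκ h1 h2
  have e1 := hden.eventually_const_lt (u := 0) (by linarith)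
  refine e1.and ?_
  -- Either `G n` is negative near x and the premise fails, or x lies on the far side of c, away
  -- from the near end point; only the far end point then needs the second inequality.
  rcases lt_or_ge (κ * (x i - c)) 0 with h | h
  · filter_upwards [(hG x).tendsto.eventually_lt_const h] with q hq h0
    exact absurd h0 (not_le.2 hq)
  · rcases lt_or_gt_of_ne hκ with hk | hk
    · have hx : x i < hi := by nlinarith
      filter_upwards [hco.eventually_lt_const hx] with q hq _ h3
      rw [farEnd, if_neg hk.not_gt] at h3
      exact ⟨by nlinarith, hq.le⟩
    · have hx : lo < x i := by nlinarith
      filter_upwards [hco.eventually_const_lt hx] with q hq _ h3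
      rw [farEnd, if_pos hk] at h3
      exact ⟨hq.le, by nlinarith⟩

theorem mem_Icc_div_add_iff {u v : ℝ} (h : 0 < u + v) :
    u / (u + v) ∈ Icc (0 : ℝ) 1 ↔ 0 ≤ u ∧ 0 ≤ v := by
  rw [mem_Icc, le_div_iff₀ h, div_le_iff₀ h]
  constructor <;> rintro ⟨h1, h2⟩ <;> constructor <;> linarith

theorem mem_Ioo_div_add_iff {u v : ℝ} (h : 0 < u + v) :
    u / (u + v) ∈ Ioo (0 : ℝ) 1 ↔ 0 < u ∧ 0 < v := by
  rw [mem_Ioo, lt_div_iff₀ h, div_lt_iff₀ h]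
  constructor <;> rintro ⟨h1, h2⟩ <;> constructor <;> linarith

/-- The set of points of the plane with coordinates in `[a, b]` and `[c, d]`. -/
def planeRect (a b c d : ℝ) : Set Plane := {z | z 0 ∈ Icc a b ∧ z 1 ∈ Icc c d}

theorem isCompact_planeRect (a b c d : ℝ) : IsCompact (planeRect a b c d) := by
  have : planeRect a b c d = PiLp.homeomorph 2 (fun _ : Fin 2 => ℝ) ⁻¹'
      (univ.pi ![Icc a b, Icc c d]) := by
    ext z
    simp [planeRect, Set.mem_pi, PiLp.homeomorph, Fin.forall_fin_two]
  rw [this]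
  refine (Homeomorph.isCompact_preimage _).2 (isCompact_univ_pi fun i => ?_)
  fin_cases i
  · exact isCompact_Icc
  · exact isCompact_Icc

/-- If two functions `G n`, `H n` are `C¹`-close to nonzero multiples of `z₁ - c` and `z₂ - d`, then
the part of the rectangle where both are positive is a region with a piecewise-`C^r` boundary. -/
theorem eventually_exists_quarter (hr : ∀ n, 1 ≤ r n) {G H : Λ → Plane → ℝ}
    {κ κ' lo lo' c c' hi hi' : ℝ} (hκ : κ ≠ 0) (hκ' : κ' ≠ 0) (h1 : lo < c) (h2 : c < hi)
    (h1' : lo' < c') (h2' : c' < hi')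
    (hG : ∀ x, C1TendstoAt l r G (fun z => κ * (z 0 - c)) x)
    (hH : ∀ x, C1TendstoAt l r H (fun z => κ' * (z 1 - c')) x) :
    ∀ᶠ n in l, ∃ R : Set Plane, IsOpen R ∧ IsConnected R ∧ HasPiecewiseCrBoundary (r n) R ∧
      (∀ z ∈ R, 0 < G n z ∧ 0 < H n z) ∧
      closure R = {z ∈ planeRect lo hi lo' hi' | 0 ≤ G n z ∧ 0 ≤ H n z} := by
  set β := farEnd κ lo hi with hβ
  set β' := farEnd κ' lo' hi' with hβ'
  have hβc : β ≠ c := farEnd_ne h1 h2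
  have hβc' : β' ≠ c' := farEnd_ne h1' h2'
  -- With the two ratios as coordinates, the quarter becomes the unit square.
  set Ξ : Λ → Plane → Plane := fun n z => !₂[G n z / (G n z + κ * (β - z 0)),
    H n z / (H n z + κ' * (β' - z 1))] with hΞ
  set A : Plane → Plane := fun z => !₂[(z 0 - c) / (β - c), (z 1 - c') / (β' - c')] with hA
  have hconv : ∀ x, C1TendstoAt l r Ξ A x := by
    intro x
    have h3 : C1TendstoAt l r (fun _ => fun q : ℝ × ℝ => (!₂[q.1, q.2] : Plane))
        (fun q : ℝ × ℝ => (!₂[q.1, q.2] : Plane)) ((x 0 - c) / (β - c), (x 1 - c') / (β' - c')) := by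
      refine C1TendstoAt.const (Eventually.of_forall fun y => ?_)
      rw [contDiffAt_euclidean]
      intro i
      fin_cases i
      · exact contDiffAt_fst
      · exact contDiffAt_snd
    exact C1TendstoAt.comp (A := fun z : Plane => ((z 0 - c) / (β - c), (z 1 - c') / (β' - c'))) hr h3
      ((sideRatio_c1TendstoAt hr 0 hκ hβc (hG x)).prodMk hr
      (sideRatio_c1TendstoAt hr 1 hκ' hβc' (hH x)))
  have ha : (β - c)⁻¹ ≠ 0 := inv_ne_zero (sub_ne_zero.2 hβc)
  have hb : (β' - c')⁻¹ ≠ 0 := inv_ne_zero (sub_ne_zero.2 hβc')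
  obtain ⟨ρ₀, hρ₀⟩ := eventually_preimage_openUnitSquare hr (diagEquiv _ _ ha hb)
    (A := A) (fun z => by
      ext i
      fin_cases i <;> simp [hA, diagEquiv_apply] <;> ring) hconv
  obtain ⟨ρ₁, hρ₁⟩ := (isCompact_planeRect lo hi lo' hi').isBounded.subset_ball 0
  filter_upwards [hρ₀ (max ρ₀ ρ₁) (le_max_left _ _),
    eventually_mem_Icc_of_side 0 hκ h1 h2 hG (isCompact_closedBall (0 : Plane) (max ρ₀ ρ₁)),
    eventually_mem_Icc_of_side 1 hκ' h1' h2' hH (isCompact_closedBall (0 : Plane) (max ρ₀ ρ₁))]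
    with n hn hGn hHn
  obtain ⟨hO, hC, hcl, hB⟩ := hn
  refine ⟨_, hO, hC, hB, ?_, ?_⟩
  · rintro z ⟨hz, hzS⟩
    have hz' := Metric.ball_subset_closedBall hz
    exact ⟨((mem_Ioo_div_add_iff (hGn z hz').1).1 (hzS 0)).1,
      ((mem_Ioo_div_add_iff (hHn z hz').1).1 (hzS 1)).1⟩
  · rw [hcl]
    ext z
    constructor
    · rintro ⟨hz, hzS⟩
      have hz' := Metric.ball_subset_closedBall hz
      have e1 := (mem_Icc_div_add_iff (hGn z hz').1).1 (hzS 0)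
      have e2 := (mem_Icc_div_add_iff (hHn z hz').1).1 (hzS 1)
      exact ⟨⟨(hGn z hz').2 e1.1 e1.2, (hHn z hz').2 e2.1 e2.2⟩, e1.1, e2.1⟩
    · rintro ⟨hz, e1, e2⟩
      have hzb : z ∈ Metric.ball (0 : Plane) (max ρ₀ ρ₁) :=
        Metric.ball_subset_ball (le_max_right _ _) (hρ₁ hz)
      have hz' := Metric.ball_subset_closedBall hzb
      refine ⟨hzb, fun i => ?_⟩
      fin_cases i
      · exact (mem_Icc_div_add_iff (hGn z hz').1).2 ⟨e1, mul_farEnd_sub_nonneg hz.1⟩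
      · exact (mem_Icc_div_add_iff (hHn z hz').1).2 ⟨e2, mul_farEnd_sub_nonneg hz.2⟩

end Regions
-- Itineraries, quarters and trapping regions.
section Itineraries

variable {p : ℕ} [NeZero p] (B : NestedBands p)

/-- The side of an interval, where for the interval around `0` the side is `s`. -/
def NestedBands.sideWith (s : Bool) (j : ZMod p) : Bool := if j = 0 then s else B.side j

/-- The itinerary of a point of the rectangle `(i, k)`, with the two free letters `s`, `s'`. -/
def NestedBands.word (i k : ZMod p) (s s' : Bool) (n : ℕ) : Bool :=
  if n % 2 = 0 then B.sideWith s (i + (n / 2 : ℕ)) else B.sideWith s' (k + (n / 2 : ℕ))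

theorem NestedBands.word_even (i k : ZMod p) (s s' : Bool) (t : ℕ) :
    B.word i k s s' (2 * t) = B.sideWith s (i + t) := by
  simp [NestedBands.word]

theorem NestedBands.word_odd (i k : ZMod p) (s s' : Bool) (t : ℕ) :
    B.word i k s s' (2 * t + 1) = B.sideWith s' (k + t) := by
  have h1 : (2 * t + 1) % 2 = 1 := by omega
  have h2 : (2 * t + 1) / 2 = t := by omega
  simp [NestedBands.word, h1, h2]

/-- The product of the larger interval `i` and the smaller interval `k`. -/
def NestedBands.rect (i k : ZMod p) : Set Plane := planeRect (B.lo i) (B.hi i) (B.lo' k) (B.hi' k)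

/-- The interior of the rectangle `(i, k)`. -/
def NestedBands.openRect (i k : ZMod p) : Set Plane :=
  {z | z 0 ∈ Ioo (B.lo i) (B.hi i) ∧ z 1 ∈ Ioo (B.lo' k) (B.hi' k)}

theorem NestedBands.isOpen_openRect (i k : ZMod p) : IsOpen (B.openRect i k) :=
  (isOpen_Ioo.preimage (by fun_prop : Continuous fun z : Plane => z 0)).inter
    (isOpen_Ioo.preimage (by fun_prop : Continuous fun z : Plane => z 1))

theorem NestedBands.openRect_subset (i k : ZMod p) : B.openRect i k ⊆ B.rect i k :=
  fun _ hz => ⟨Ioo_subset_Icc_self hz.1, Ioo_subset_Icc_self hz.2⟩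

theorem NestedBands.isCompact_rect (i k : ZMod p) : IsCompact (B.rect i k) :=
  isCompact_planeRect _ _ _ _

theorem NestedBands.disjoint_rect {i k i' k' : ZMod p} (h : (i, k) ≠ (i', k')) :
    Disjoint (B.rect i k) (B.rect i' k') := by
  rw [disjoint_left]
  rintro z ⟨h1, h2⟩ ⟨h3, h4⟩
  by_cases hi : i = i'
  · have hk : k ≠ k' := fun hk => h (by rw [hi, hk])
    have hsub : ∀ j, Icc (B.lo' j) (B.hi' j) ⊆ Icc (B.lo j) (B.hi j) := fun j =>
      Icc_subset_Icc (B.lo_lt_lo' j).le (B.hi'_lt_hi j).le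
    exact disjoint_left.1 (B.disjoint hk) (hsub _ h2) (hsub _ h4)
  · exact disjoint_left.1 (B.disjoint hi) h1 h3

theorem NestedBands.nonempty_rect (i k : ZMod p) : (B.rect i k).Nonempty :=
  ⟨!₂[B.mid i, B.mid k], ⟨(B.lo_lt i).le, (B.lt_hi i).le⟩, ⟨(B.lo'_lt k).le, (B.lt_hi' k).le⟩⟩

theorem add_natCast_eq_zero_iff {i : ZMod p} {t : ℕ} (ht : t < p) :
    i + t = 0 ↔ t = (-i).val := by
  constructor
  · intro h
    have h1 : (t : ZMod p) = -i := by rw [eq_neg_iff_add_eq_zero, add_comm]; exact h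
    rw [← h1, ZMod.val_natCast_of_lt ht]
  · intro h
    rw [h, ZMod.natCast_zmod_val]; ring

theorem prod_range_zmod (h : ZMod p → ℝ) (i : ZMod p) :
    ∏ t ∈ Finset.range p, h (i + t) = ∏ j, h j := by
  refine Finset.prod_bij' (fun t _ => i + t) (fun j _ => (j - i).val) ?_ ?_ ?_ ?_ ?_
  · simp
  · intro j _
    exact Finset.mem_range.2 (ZMod.val_lt _)
  · intro t ht
    simp [ZMod.val_natCast_of_lt (Finset.mem_range.1 ht)]
  · intro j _
    simp
  · simp

/-- The points `B.mid` form a backward orbit of the turning point, and before time `(-i).val` the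
orbit visits only intervals with a definite side, so the free letter is not used. -/
theorem NestedBands.wordIter_mid (s : Bool) (i : ZMod p) :
    wordIter (fun a u => 1 + B.c a * u) (fun j => B.sideWith s (i + j)) (-i).val (B.mid i) = 0 := by
  have key : ∀ t ≤ (-i).val,
      wordIter (fun a u => 1 + B.c a * u) (fun j => B.sideWith s (i + j)) t (B.mid i) =
        B.mid (i + t) := by
    intro t
    induction t with
    | zero => intro _; simp [wordIter]
    | succ t ih =>
      intro ht
      have h0 : i + t ≠ 0 := fun h => by
        have := (add_natCast_eq_zero_iff (ht.trans (ZMod.val_lt _).le)).1 h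
        omega
      simp only [wordIter, Function.comp_apply]
      rw [ih (by omega), NestedBands.sideWith, if_neg h0, B.mid_succ _ h0]
      push_cast; ring_nf
  rw [key _ le_rfl, ZMod.natCast_zmod_val, add_neg_cancel, B.mid_zero]

/-- The composition is affine in the first coordinate and vanishes at the preimage of the turning
point: the limiting switching curve is a vertical line. At odd times it is, likewise, a horizontal
one. -/
theorem NestedBands.exists_even_crossing (i k : ZMod p) (s s' : Bool) :
    ∃ κ : ℝ, κ ≠ 0 ∧ ∀ z, wordIter (tentPiece B.c) (B.word i k s s') (2 * (-i).val) z 0 =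
      κ * (z 0 - B.mid i) := by
  refine ⟨∏ j ∈ Finset.range (-i).val, B.c (B.sideWith s (i + j)),
    Finset.prod_ne_zero_iff.2 fun j _ => B.c_ne_zero _, fun z => ?_⟩
  rw [(tentPiece_wordIter _ _ _ _).1]
  simp only [B.word_even]
  change wordIter _ _ _ (z 0) = _
  rw [affine_wordIter _ _ _ (z 0) (B.mid i), B.wordIter_mid, zero_add]

theorem NestedBands.exists_odd_crossing (i k : ZMod p) (s s' : Bool) :
    ∃ κ : ℝ, κ ≠ 0 ∧ ∀ z, wordIter (tentPiece B.c) (B.word i k s s') (2 * (-k).val + 1) z 0 =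
      κ * (z 1 - B.mid k) := by
  refine ⟨∏ j ∈ Finset.range (-k).val, B.c (B.sideWith s' (k + j)),
    Finset.prod_ne_zero_iff.2 fun j _ => B.c_ne_zero _, fun z => ?_⟩
  rw [(tentPiece_wordIter _ _ _ _).2]
  simp only [B.word_odd]
  change wordIter _ _ _ (z 1) = _
  rw [affine_wordIter _ _ _ (z 1) (B.mid k), B.wordIter_mid, zero_add]

/-- In 2p steps each coordinate runs exactly once round the cycle, so the diagonal entries are full
cyclic products, whatever the starting indices. -/
theorem NestedBands.hasFDerivAt_wordIter (i k : ZMod p) (s s' : Bool) :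
    ∃ (P P' : ℝ) (hP : P ≠ 0) (hP' : P' ≠ 0), B.α ≤ |P| ∧ B.α ≤ |P'| ∧ ∀ z,
      HasFDerivAt (wordIter (tentPiece B.c) (B.word i k s s') (2 * p))
        (diagEquiv P P' hP hP' : Plane →L[ℝ] Plane) z := by
  have hα := B.one_lt
  have h1 : B.α ≤ |∏ j ∈ Finset.range p, B.c (B.sideWith s (i + j))| := by
    rw [prod_range_zmod (fun j => B.c (B.sideWith s j))]; exact B.expanding s
  have h2 : B.α ≤ |∏ j ∈ Finset.range p, B.c (B.sideWith s' (k + j))| := by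
    rw [prod_range_zmod (fun j => B.c (B.sideWith s' j))]; exact B.expanding s'
  refine ⟨_, _, abs_pos.1 (by linarith), abs_pos.1 (by linarith), h1, h2, fun z => ?_⟩
  set P := ∏ j ∈ Finset.range p, B.c (B.sideWith s (i + j))
  set P' := ∏ j ∈ Finset.range p, B.c (B.sideWith s' (k + j))
  have hP : P ≠ 0 := abs_pos.1 (by linarith)
  have hP' : P' ≠ 0 := abs_pos.1 (by linarith)
  have : wordIter (tentPiece B.c) (B.word i k s s') (2 * p) = fun z => diagEquiv P P' hP hP' z +
      !₂[wordIter (fun a u => 1 + B.c a * u) (fun j => B.sideWith s (i + j)) p 0,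
        wordIter (fun a u => 1 + B.c a * u) (fun j => B.sideWith s' (k + j)) p 0] := by
    ext z : 1
    rw [(tentPiece_wordIter _ _ _ _).1]
    simp only [B.word_even, B.word_odd]
    rw [affine_wordIter _ _ _ (z 0) 0, affine_wordIter _ _ _ (z 1) 0, diagEquiv_apply]
    ext j
    fin_cases j <;> simp <;> ring
  rw [this]
  exact (diagEquiv P P' hP hP').hasFDerivAt.add_const _

variable {F : Plane → Plane} {Fs : Bool → Plane → Plane}

theorem NestedBands.iterate_mem_rect
    (hF : ∀ i k, ∀ z ∈ B.rect i k, F z ∈ B.openRect k (i + 1)) {i k : ZMod p} {z : Plane}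
    (hz : z ∈ B.rect i k) (t : ℕ) :
    F^[2 * t] z ∈ B.rect (i + t) (k + t) ∧ F^[2 * t + 1] z ∈ B.rect (k + t) (i + t + 1) := by
  have step : ∀ i k, ∀ z ∈ B.rect i k, F z ∈ B.rect k (i + 1) := fun i k z hz =>
    B.openRect_subset _ _ (hF i k z hz)
  have h2 : ∀ t : ℕ, F^[2 * t] z ∈ B.rect (i + t) (k + t) := by
    intro t
    induction t with
    | zero => simpa using hz
    | succ t ih =>
      rw [show 2 * (t + 1) = (2 * t + 1) + 1 by ring, Function.iterate_succ_apply',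
        Function.iterate_succ_apply']
      have := step _ _ _ (step _ _ _ ih)
      push_cast
      rwa [add_assoc, add_assoc] at this
  refine ⟨h2 t, ?_⟩
  rw [Function.iterate_succ_apply']
  exact step _ _ _ (h2 t)

/-- Inside the rectangle `(i, k)`, iterates agree with compositions of smooth pieces according to
the sides on which the two iterates lie that may meet the switching manifold. -/
theorem NestedBands.iterate_eq_wordIter
    (hF : ∀ i k, ∀ z ∈ B.rect i k, F z ∈ B.openRect k (i + 1))
    (hFs : ∀ i k, ∀ z ∈ B.rect i k, ∀ s, 0 ≤ sideSign s * z 0 → F z = Fs s z)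
    {i k : ZMod p} {z : Plane} (hz : z ∈ B.rect i k) {s s' : Bool}
    (h : 0 ≤ sideSign s * F^[2 * (-i).val] z 0 ∨
      0 ≤ sideSign s * wordIter Fs (B.word i k s s') (2 * (-i).val) z 0)
    (h' : 0 ≤ sideSign s' * F^[2 * (-k).val + 1] z 0 ∨
      0 ≤ sideSign s' * wordIter Fs (B.word i k s s') (2 * (-k).val + 1) z 0)
    {n : ℕ} (hn : n ≤ 2 * p) : F^[n] z = wordIter Fs (B.word i k s s') n z := by
  induction n with
  | zero => rfl
  | succ n ih =>
    have ih := ih (by omega)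
    rw [Function.iterate_succ_apply', wordIter, Function.comp_apply, ← ih]
    rcases Nat.even_or_odd' n with ⟨t, rfl | rfl⟩
    · have hm := (B.iterate_mem_rect hF hz t).1
      refine hFs _ _ _ hm _ ?_
      rw [B.word_even, NestedBands.sideWith]
      split_ifs with h0
      · obtain rfl := (add_natCast_eq_zero_iff (by omega)).1 h0
        rcases h with h | h
        · exact h
        · rwa [ih]
      · exact (B.sign _ h0 _ hm.1).le
    · have hm := (B.iterate_mem_rect hF hz t).2
      refine hFs _ _ _ hm _ ?_
      rw [B.word_odd, NestedBands.sideWith]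
      split_ifs with h0
      · obtain rfl := (add_natCast_eq_zero_iff (by omega)).1 h0
        rcases h' with h | h
        · exact h
        · rwa [ih]
      · exact (B.sign _ h0 _ hm.1).le

theorem exists_sideSign_mul_nonneg (x : ℝ) : ∃ s, 0 ≤ sideSign s * x := by
  rcases le_total 0 x with h | h
  · exact ⟨true, by simpa [sideSign] using h⟩
  · exact ⟨false, by simpa [sideSign] using h⟩

theorem eq_of_sideSign_mul_pos {x : ℝ} {s t : Bool} (hs : 0 < sideSign s * x)
    (ht : 0 < sideSign t * x) : s = t := by
  cases s <;> cases t <;> simp [sideSign] at hs ht ⊢ <;> linarith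

/-- The part of the rectangle `(i, k)` with itinerary given by the letters `s`, `s'`. -/
structure NestedBands.IsQuarter (r : ℕ∞) (Fs : Bool → Plane → Plane) (i k : ZMod p) (s s' : Bool)
    (R : Set Plane) : Prop where
  isOpen : IsOpen R
  isConnected : IsConnected R
  boundary : HasPiecewiseCrBoundary r R
  pos : ∀ z ∈ R, 0 < sideSign s * wordIter Fs (B.word i k s s') (2 * (-i).val) z 0 ∧
    0 < sideSign s' * wordIter Fs (B.word i k s s') (2 * (-k).val + 1) z 0
  closure_eq : closure R = {z ∈ B.rect i k |
    0 ≤ sideSign s * wordIter Fs (B.word i k s s') (2 * (-i).val) z 0 ∧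
    0 ≤ sideSign s' * wordIter Fs (B.word i k s s') (2 * (-k).val + 1) z 0}

/-- All that is needed of a map in order that it is piecewise expanding on invariant unions of
rectangles. -/
structure NestedBands.IsGood (r : ℕ∞) (F : Plane → Plane) (Fs : Bool → Plane → Plane) : Prop where
  maps : ∀ i k, ∀ z ∈ B.rect i k, F z ∈ B.openRect k (i + 1)
  eq_piece : ∀ i k, ∀ z ∈ B.rect i k, ∀ s, 0 ≤ sideSign s * z 0 → F z = Fs s z
  quarter : ∀ i k s s', ∃ R, B.IsQuarter r Fs i k s s' R
  smooth : ∀ i k s s', ∃ V, IsOpen V ∧ B.rect i k ⊆ V ∧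
    ContDiffOn ℝ r (wordIter Fs (B.word i k s s') (2 * p)) V
  expanding : ∀ i k s s', ∀ z ∈ B.rect i k, ∀ v,
    (1 + B.α) / 2 * ‖v‖ ≤ ‖fderiv ℝ (wordIter Fs (B.word i k s s') (2 * p)) z v‖

variable {B} {r : ℕ∞}

theorem NestedBands.IsGood.iterate_mem (hg : B.IsGood r F Fs) {i k : ZMod p} {z : Plane}
    (hz : z ∈ B.rect i k) : F^[2 * p] z ∈ B.rect i k := by
  simpa using (B.iterate_mem_rect hg.maps hz p).1

/-- The pieces are the four quarters of every rectangle in S. They are disjoint because the signs at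
the two critical times are strict, and their closures cover because each point admits some weak sign
at both times. Any S will do, since the iterate of order 2p preserves each rectangle. -/
theorem NestedBands.IsGood.isPiecewiseCrExpanding (hg : B.IsGood r F Fs)
    (S : Set (ZMod p × ZMod p)) :
    IsPiecewiseCrExpanding r F^[2 * p] (⋃ a ∈ S, B.rect a.1 a.2) := by
  classical
  choose R hR using hg.quarter
  have hsub : ∀ {i k s s'}, closure (R i k s s') ⊆ B.rect i k := fun {i k s s'} z hz => by
    rw [(hR i k s s').closure_eq] at hz; exact hz.1
  have hiter : ∀ {i k s s' z}, z ∈ R i k s s' → ∀ {n}, n ≤ 2 * p →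
      F^[n] z = wordIter Fs (B.word i k s s') n z := fun {i k s s' z} hz n hn => by
    obtain ⟨h1, h2⟩ := (hR i k s s').pos z hz
    exact B.iterate_eq_wordIter hg.maps hg.eq_piece (hsub (subset_closure hz)) (Or.inr h1.le)
      (Or.inr h2.le) hn
  let ι := S × (Bool × Bool)
  let e := Fintype.equivFin ι
  let R' : ι → Set Plane := fun a => R a.1.1.1 a.1.1.2 a.2.1 a.2.2
  have hdisj : ∀ {a b : ι}, a ≠ b → Disjoint (R' a) (R' b) := by
    intro a b hab
    rw [disjoint_left]
    intro z hza hzb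
    apply hab
    have h1 : a.1 = b.1 := by
      by_contra h
      exact disjoint_left.1 (B.disjoint_rect (fun h' => h (Subtype.ext h')))
        (hsub (subset_closure hza)) (hsub (subset_closure hzb))
    obtain ⟨⟨⟨i, k⟩, hik⟩, s, s'⟩ := a
    obtain ⟨a', t, t'⟩ := b
    simp only at h1
    subst h1
    have pa := (hR i k s s').pos z hza
    have pb := (hR i k t t').pos z hzb
    have hi := ZMod.val_lt (-i)
    have hk := ZMod.val_lt (-k)
    rw [← hiter hza (by omega), ← hiter hza (by omega)] at pa
    rw [← hiter hzb (by omega), ← hiter hzb (by omega)] at pb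
    rw [eq_of_sideSign_mul_pos pa.1 pb.1, eq_of_sideSign_mul_pos pa.2 pb.2]
  have hΩ : IsCompact (⋃ a ∈ S, B.rect a.1 a.2) :=
    S.toFinite.isCompact_biUnion fun a _ => B.isCompact_rect _ _
  have hmem : ∀ (a : ι), B.rect a.1.1.1 a.1.1.2 ⊆ ⋃ a ∈ S, B.rect a.1 a.2 := fun a =>
    subset_biUnion_of_mem (u := fun a : ZMod p × ZMod p => B.rect a.1 a.2) a.1.2
  have hext : ∀ a : ι, ∃ (V : Set Plane) (G : Plane → Plane), IsOpen V ∧ closure (R' a) ⊆ V ∧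
      ContDiffOn ℝ r G V ∧ EqOn G F^[2 * p] (R' a) := fun a => by
    obtain ⟨V, hV, hsV, hc⟩ := hg.smooth a.1.1.1 a.1.1.2 a.2.1 a.2.2
    exact ⟨V, _, hV, hsub.trans hsV, hc, fun z hz => (hiter hz le_rfl).symm⟩
  refine ⟨Fintype.card ι, R' ∘ e.symm, ⟨hΩ, ?_, fun j => (hR _ _ _ _).isOpen,
    fun j => (hR _ _ _ _).isConnected, fun j => (subset_closure.trans hsub).trans (hmem _),
    fun i j hij => hdisj (e.symm.injective.ne hij), fun j => (hR _ _ _ _).boundary, ?_, ?_,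
    fun j => hext _⟩, (1 + B.α) / 2, by linarith [B.one_lt], ?_⟩
  · intro z hz
    obtain ⟨a, ha, hz⟩ := mem_iUnion₂.1 hz
    exact mem_iUnion₂.2 ⟨a, ha, hg.iterate_mem hz⟩
  · apply Subset.antisymm
    · intro z hz
      obtain ⟨⟨i, k⟩, ha, hz⟩ := mem_iUnion₂.1 hz
      obtain ⟨s, hs⟩ := exists_sideSign_mul_nonneg (F^[2 * (-i).val] z 0)
      obtain ⟨s', hs'⟩ := exists_sideSign_mul_nonneg (F^[2 * (-k).val + 1] z 0)
      have hi := ZMod.val_lt (-i)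
      have hk := ZMod.val_lt (-k)
      have key := fun {n} (hn : n ≤ 2 * p) =>
        B.iterate_eq_wordIter hg.maps hg.eq_piece hz (Or.inl hs) (Or.inl hs') hn
      refine mem_iUnion.2 ⟨e ⟨⟨(i, k), ha⟩, s, s'⟩, ?_⟩
      rw [Function.comp_apply, e.symm_apply_apply]
      change z ∈ closure (R i k s s')
      rw [(hR i k s s').closure_eq]
      refine ⟨hz, ?_, ?_⟩
      · rwa [← key (by omega)]
      · rwa [← key (by omega)]
    · exact iUnion_subset fun j => hsub.trans (hmem _)
  · intro j
    obtain ⟨V, G, -, hV, hG, hE⟩ := hext (e.symm j)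
    exact (hG.mono (subset_closure.trans hV)).congr fun z hz => (hE hz).symm
  · intro z hz v
    obtain ⟨j, hz⟩ := mem_iUnion.1 hz
    have hz : z ∈ R' (e.symm j) := hz
    have : F^[2 * p] =ᶠ[𝓝 z] wordIter Fs (B.word (e.symm j).1.1.1 (e.symm j).1.1.2
        (e.symm j).2.1 (e.symm j).2.2) (2 * p) := by
      filter_upwards [(hR _ _ _ _).isOpen.mem_nhds hz] with y hy using hiter hy le_rfl
    rw [this.fderiv_eq]
    exact hg.expanding _ _ _ _ z (hsub (subset_closure hz)) v

theorem NestedBands.IsGood.isTrappingRegion (hg : B.IsGood r F Fs) {S : Set (ZMod p × ZMod p)}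
    (hS : ∀ a ∈ S, (a.2, a.1 + 1) ∈ S) : IsTrappingRegion F (⋃ a ∈ S, B.rect a.1 a.2) := by
  refine ⟨S.toFinite.isCompact_biUnion fun a _ => B.isCompact_rect _ _, ?_⟩
  rintro _ ⟨z, hz, rfl⟩
  obtain ⟨a, ha, hz⟩ := mem_iUnion₂.1 hz
  refine mem_interior.2 ⟨B.openRect a.2 (a.1 + 1), ?_, B.isOpen_openRect _ _, hg.maps _ _ _ hz⟩
  exact (B.openRect_subset _ _).trans
    (subset_biUnion_of_mem (u := fun a : ZMod p × ZMod p => B.rect a.1 a.2) (hS a ha))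

/-- The set of pairs of indices `(i, k)` with `i - k` equal to `n` or `-1 - n`. -/
def differenceClass (p n : ℕ) : Set (ZMod p × ZMod p) := {a | a.1 - a.2 = n ∨ a.1 - a.2 = -1 - n}

/-- For n < N the residue -1 - n is represented by 2N - 1 - n ≥ N, so it never meets the residues 0,
…, N - 1 that label the classes. Hence 2N intervals yield N regions. -/
theorem disjoint_differenceClass {N m n : ℕ} (hm : m < N) (hn : n < N) (h : m ≠ n) :
    Disjoint (differenceClass (2 * N) m) (differenceClass (2 * N) n) := by
  have key : ∀ a b : ℕ, a < 2 * N → b < 2 * N → (a : ZMod (2 * N)) = b → a = b :=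
    fun a b ha hb hab => by
      rw [ZMod.natCast_eq_natCast_iff] at hab
      exact Nat.ModEq.eq_of_lt_of_lt hab ha hb
  have key2 : ∀ a b : ℕ, a < N → b < N → (a : ZMod (2 * N)) ≠ -1 - b := fun a b ha hb hab => by
    have h1 : ((a + b + 1 : ℕ) : ZMod (2 * N)) = 0 := by
      push_cast; rw [hab]; ring
    rw [ZMod.natCast_eq_zero_iff] at h1
    have := Nat.le_of_dvd (by omega) h1
    omega
  rw [disjoint_left]
  rintro a (h1 | h1) (h2 | h2) <;> rw [h1] at h2
  · exact h (key _ _ (by omega) (by omega) h2)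
  · exact key2 _ _ hm hn h2
  · exact key2 _ _ hn hm h2.symm
  · exact h (key _ _ (by omega) (by omega) (by linear_combination -h2))

theorem NestedBands.IsGood.exists_trappingRegions {N : ℕ} [NeZero (2 * N)]
    {B : NestedBands (2 * N)} (hg : B.IsGood r F Fs) :
    ∃ Ω : Fin N → Set Plane, (Pairwise fun i j => Disjoint (Ω i) (Ω j)) ∧
      ∀ i, (Ω i).Nonempty ∧ IsTrappingRegion F (Ω i) ∧
        IsPiecewiseCrExpanding r F^[2 * (2 * N)] (Ω i) := by
  refine ⟨fun n => ⋃ a ∈ differenceClass (2 * N) n, B.rect a.1 a.2, ?_, fun n => ⟨?_, ?_, ?_⟩⟩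
  · intro m n hmn
    rw [disjoint_left]
    intro z hz hz'
    obtain ⟨a, ha, hza⟩ := mem_iUnion₂.1 hz
    obtain ⟨b, hb, hzb⟩ := mem_iUnion₂.1 hz'
    by_cases hab : a = b
    · subst hab
      exact disjoint_left.1 (disjoint_differenceClass m.2 n.2 (fun h => hmn (Fin.ext h))) ha hb
    · exact disjoint_left.1 (B.disjoint_rect hab) hza hzb
  · obtain ⟨z, hz⟩ := B.nonempty_rect (n : ℕ) 0
    exact ⟨z, mem_iUnion₂.2 ⟨((n : ℕ), 0), Or.inl (sub_zero _), hz⟩⟩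
  · refine hg.isTrappingRegion ?_
    rintro ⟨i, k⟩ (h | h)
    · exact Or.inr (by simp only at h ⊢; linear_combination -h)
    · exact Or.inl (by simp only at h ⊢; linear_combination -h)
  · exact hg.isPiecewiseCrExpanding _

end Itineraries
-- Robustness under C¹ convergence.
section Convergence

variable {Λ : Type*} {l : Filter Λ} {r : Λ → ℕ∞}

theorem contDiff_tentPiece (c : Bool → ℝ) (s : Bool) {n : WithTop ℕ∞} :
    ContDiff ℝ n (tentPiece c s) := by
  rw [contDiff_euclidean]
  intro i
  fin_cases i
  · exact (by fun_prop : ContDiff ℝ n fun z : Plane => z 1)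
  · exact (by fun_prop : ContDiff ℝ n fun z : Plane => 1 + c s * z 0)

theorem wordIter_c1TendstoAt (hr : ∀ n, 1 ≤ r n) {Fs : Λ → Bool → Plane → Plane}
    {As : Bool → Plane → Plane} (h : ∀ s x, C1TendstoAt l r (fun n => Fs n s) (As s) x)
    (s : ℕ → Bool) (t : ℕ) (x : Plane) :
    C1TendstoAt l r (fun n => wordIter (Fs n) s t) (wordIter As s t) x := by
  induction t with
  | zero => exact C1TendstoAt.const (Eventually.of_forall fun _ => contDiffAt_id)
  | succ t ih => exact (h (s t) _).comp hr ih

theorem sideSign_ne_zero (s : Bool) : sideSign s ≠ 0 := by cases s <;> simp [sideSign]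

theorem sideSign_mul_coord_c1TendstoAt (hr : ∀ n, 1 ≤ r n) {G : Λ → Plane → Plane}
    {A : Plane → Plane} {x : Plane} (h : C1TendstoAt l r G A x) (s : Bool) :
    C1TendstoAt l r (fun n z => sideSign s * G n z 0) (fun z => sideSign s * A z 0) x := by
  have h1 : C1TendstoAt l r (fun _ => fun z : Plane => sideSign s * z 0)
      (fun z : Plane => sideSign s * z 0) (A x) :=
    C1TendstoAt.const (Eventually.of_forall fun _ => by fun_prop)
  exact h1.comp hr h

variable {p : ℕ} [NeZero p] (B : NestedBands p)

/-- For the limiting product map the inclusions and the expansion hold with a margin on the compact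
rectangles, and the switching curves are straight lines crossing them, so every clause passes to
nearby maps. -/
theorem NestedBands.eventually_isGood (hr : ∀ n, 1 ≤ r n) {Fs : Λ → Bool → Plane → Plane}
    {F : Λ → Plane → Plane} (h : ∀ s x, C1TendstoAt l r (fun n => Fs n s) (tentPiece B.c s) x)
    (hF : ∀ x, ∀ᶠ q in l ×ˢ 𝓝 x, ∀ s, 0 ≤ sideSign s * (q.2 : Plane) 0 → F q.1 q.2 = Fs q.1 s q.2) :
    ∀ᶠ n in l, B.IsGood (r n) (F n) (Fs n) := by
  have hw := wordIter_c1TendstoAt hr h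
  have hpiece : ∀ᶠ n in l, ∀ i k, ∀ z ∈ B.rect i k, ∀ s, 0 ≤ sideSign s * z 0 →
      F n z = Fs n s z := by
    simp only [eventually_all]
    exact fun i k => (B.isCompact_rect i k).eventually_forall_of_prod fun x _ => hF x
  have hmaps : ∀ᶠ n in l, ∀ i k, ∀ z ∈ B.rect i k, F n z ∈ B.openRect k (i + 1) := by
    simp only [eventually_all]
    refine fun i k => (B.isCompact_rect i k).eventually_forall_of_prod fun x hx => ?_
    have key : ∀ s, ∀ᶠ q in l ×ˢ 𝓝 x, 0 ≤ sideSign s * (q.2 : Plane) 0 →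
        Fs q.1 s q.2 ∈ B.openRect k (i + 1) := by
      intro s
      rcases le_or_gt 0 (sideSign s * x 0) with h0 | h0
      · have hmem : tentPiece B.c s x ∈ B.openRect k (i + 1) := by
          refine ⟨?_, B.maps' i _ hx.1 s h0⟩
          -- The new first coordinate is a copy of the old second one; it is interior only because
          -- it moves from the smaller interval into the larger.
          exact ⟨(B.lo_lt_lo' k).trans_le hx.2.1, hx.2.2.trans_lt (B.hi'_lt_hi k)⟩
        filter_upwards [(h s x).tendsto.eventually
          ((B.isOpen_openRect k (i + 1)).mem_nhds hmem)] with q hq _ using hq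
      · have hco : Tendsto (fun q : Λ × Plane => sideSign s * (q.2 : Plane) 0) (l ×ˢ 𝓝 x)
            (𝓝 (sideSign s * x 0)) :=
          ((by fun_prop : Continuous fun z : Plane => sideSign s * z 0).tendsto x).comp tendsto_snd
        filter_upwards [hco.eventually_lt_const h0] with q hq h1
        exact absurd h1 (not_le.2 hq)
    filter_upwards [hF x, key true, key false] with q h1 h2 h3
    obtain ⟨s, hs⟩ := exists_sideSign_mul_nonneg (q.2 0)
    rw [h1 s hs]
    cases s
    · exact h3 hs
    · exact h2 hs
  have hquarter : ∀ᶠ n in l, ∀ i k s s', ∃ R, B.IsQuarter (r n) (Fs n) i k s s' R := by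
    simp only [eventually_all]
    intro i k s s'
    obtain ⟨κ, hκ, hκe⟩ := B.exists_even_crossing i k s s'
    obtain ⟨κ', hκ', hκe'⟩ := B.exists_odd_crossing i k s s'
    have hG : ∀ x, C1TendstoAt l r
        (fun n z => sideSign s * wordIter (Fs n) (B.word i k s s') (2 * (-i).val) z 0)
        (fun z => sideSign s * κ * (z 0 - B.mid i)) x := fun x => by
      have := sideSign_mul_coord_c1TendstoAt hr (hw (B.word i k s s') (2 * (-i).val) x) s
      simpa only [hκe, ← mul_assoc] using this
    have hH : ∀ x, C1TendstoAt l r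
        (fun n z => sideSign s' * wordIter (Fs n) (B.word i k s s') (2 * (-k).val + 1) z 0)
        (fun z => sideSign s' * κ' * (z 1 - B.mid k)) x := fun x => by
      have := sideSign_mul_coord_c1TendstoAt hr (hw (B.word i k s s') (2 * (-k).val + 1) x) s'
      simpa only [hκe', ← mul_assoc] using this
    filter_upwards [eventually_exists_quarter hr (mul_ne_zero (sideSign_ne_zero s) hκ)
      (mul_ne_zero (sideSign_ne_zero s') hκ') (B.lo_lt i) (B.lt_hi i) (B.lo'_lt k) (B.lt_hi' k)
      hG hH] with n hn
    obtain ⟨R, h1, h2, h3, h4, h5⟩ := hn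
    exact ⟨R, h1, h2, h3, h4, h5⟩
  have hsmooth : ∀ᶠ n in l, ∀ i k s s', ∃ V, IsOpen V ∧ B.rect i k ⊆ V ∧
      ContDiffOn ℝ (r n) (wordIter (Fs n) (B.word i k s s') (2 * p)) V := by
    simp only [eventually_all]
    intro i k s s'
    obtain ⟨ρ, hρ⟩ := (B.isCompact_rect i k).isBounded.subset_ball 0
    filter_upwards [(isCompact_closedBall (0 : Plane) ρ).eventually_forall_of_prod
      (P := fun n z => ContDiffAt ℝ (r n) (wordIter (Fs n) (B.word i k s s') (2 * p)) z)
      fun x _ => (hw (B.word i k s s') (2 * p) x).contDiffAt] with n hn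
    exact ⟨Metric.ball 0 ρ, Metric.isOpen_ball, hρ, fun z hz =>
      (hn z (Metric.ball_subset_closedBall hz)).contDiffWithinAt⟩
  have hexp : ∀ᶠ n in l, ∀ i k s s', ∀ z ∈ B.rect i k, ∀ v,
      (1 + B.α) / 2 * ‖v‖ ≤ ‖fderiv ℝ (wordIter (Fs n) (B.word i k s s') (2 * p)) z v‖ := by
    simp only [eventually_all]
    intro i k s s'
    obtain ⟨P, P', hP, hP', h1, h2, hd⟩ := B.hasFDerivAt_wordIter i k s s'
    refine (B.isCompact_rect i k).eventually_forall_of_prod (P := fun n z => ∀ v,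
      (1 + B.α) / 2 * ‖v‖ ≤ ‖fderiv ℝ (wordIter (Fs n) (B.word i k s s') (2 * p)) z v‖)
      fun x _ => ?_
    have h3 := (hw (B.word i k s s') (2 * p) x).tendsto_fderiv
    rw [(hd x).fderiv] at h3
    have h4 := (h3.sub_const (diagEquiv P P' hP hP' : Plane →L[ℝ] Plane)).norm
    rw [sub_self, norm_zero] at h4
    have hα := B.one_lt
    -- The limit expands by α, and α - (α - 1)/2 = (1 + α)/2.
    filter_upwards [h4.eventually_le_const (u := (B.α - 1) / 2) (by linarith)] with q hq v
    have h5 := le_norm_diagEquiv hP hP' (by linarith) h1 h2 v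
    have h6 := ContinuousLinearMap.le_of_opNorm_le _ hq v
    have h7 := norm_sub_norm_le (diagEquiv P P' hP hP' v)
      (fderiv ℝ (wordIter (Fs q.1) (B.word i k s s') (2 * p)) q.2 v)
    rw [norm_sub_rev] at h7
    simp only [sub_apply, ContinuousLinearEquiv.coe_coe] at h6
    linarith
  filter_upwards [hpiece, hmaps, hquarter, hsmooth, hexp] with n h1 h2 h3 h4 h5
  exact ⟨h2, h1, h3, h4, h5⟩

end Convergence

/-! ### Persistence of attracting fixed points. -/

section StableFixedPoints

theorem IsAsymptoticallyStableFixedPoint.conj {F f : Plane → Plane} {x : Plane}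
    (h : IsAsymptoticallyStableFixedPoint F x) (H : Plane ≃ₜ Plane)
    (hH : Function.Semiconj H F f) : IsAsymptoticallyStableFixedPoint f (H x) := by
  have hiter : ∀ (n : ℕ) y, f^[n] y = H (F^[n] (H.symm y)) := fun n y => by
    have := (hH.iterate_right n) (H.symm y)
    rw [H.apply_symm_apply] at this
    exact this.symm
  have hpull : ∀ η > 0, ∃ η' > 0, ∀ y, dist y (H x) < η' → dist (H.symm y) x < η := by
    intro η hη
    have := Metric.continuousAt_iff.1 (H.symm.continuous.continuousAt (x := H x)) η hη
    simpa using this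
  refine ⟨?_, fun ε hε => ?_, ?_⟩
  · have := hH x
    rw [h.isFixedPt.eq] at this
    exact this.symm
  · obtain ⟨ε', hε', h1⟩ := Metric.continuousAt_iff.1 (H.continuous.continuousAt (x := x)) ε hε
    obtain ⟨η, hη, h2⟩ := h.stable ε' hε'
    obtain ⟨η', hη', h3⟩ := hpull η hη
    refine ⟨η', hη', fun y hy n => ?_⟩
    rw [hiter]
    exact h1 (h2 _ (h3 y hy) n)
  · obtain ⟨η, hη, h2⟩ := h.attracting
    obtain ⟨η', hη', h3⟩ := hpull η hη
    refine ⟨η', hη', fun y hy => ?_⟩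
    simp only [hiter]
    exact (H.continuous.tendsto x).comp (h2 _ (h3 y hy))

/-- A map that contracts a closed ball and moves its centre only a little has an asymptotically
stable fixed point. -/
theorem exists_stable_of_contraction {G : Plane → Plane} {c : Plane} {δ K : ℝ} (hδ : 0 < δ)
    (hK0 : 0 ≤ K) (hK1 : K < 1)
    (hG : ∀ x ∈ Metric.closedBall c δ, ∀ y ∈ Metric.closedBall c δ,
      dist (G x) (G y) ≤ K * dist x y)
    (hc : dist (G c) c < (1 - K) * δ) : ∃ x, IsAsymptoticallyStableFixedPoint G x := by
  have hcmem : c ∈ Metric.closedBall c δ := Metric.mem_closedBall_self hδ.le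
  have hlt : ∀ x ∈ Metric.closedBall c δ, dist (G x) c < δ := by
    intro x hx
    have h1 := dist_triangle (G x) (G c) c
    have h2 := hG x hx c hcmem
    have h3 := mul_le_mul_of_nonneg_left (Metric.mem_closedBall.1 hx) hK0
    linarith
  have hmaps : MapsTo G (Metric.closedBall c δ) (Metric.closedBall c δ) := fun x hx =>
    (hlt x hx).le
  have hcontr : ContractingWith ⟨K, hK0⟩ (hmaps.restrict G _ _) := by
    refine ⟨by exact_mod_cast hK1, LipschitzWith.of_dist_le_mul fun x y => ?_⟩
    exact hG x x.2 y y.2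
  obtain ⟨x, hx, hfix, -⟩ := hcontr.exists_fixedPoint' Metric.isClosed_closedBall.isComplete hmaps
    hcmem (edist_ne_top _ _)
  -- The fixed point is interior to the ball, so a ball about it stays in the domain of contraction.
  have hxlt : dist x c < δ := by
    have := hlt x hx
    rwa [hfix.eq] at this
  have hiter : ∀ y, dist y x < δ - dist x c → ∀ n : ℕ,
      dist (G^[n] y) x ≤ K ^ n * dist y x := by
    intro y hy n
    induction n with
    | zero => simp
    | succ n ih =>
      have h1 : dist (G^[n] y) x ≤ dist y x := ih.trans
        (mul_le_of_le_one_left dist_nonneg (pow_le_one₀ hK0 hK1.le))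
      have h2 : G^[n] y ∈ Metric.closedBall c δ := by
        rw [Metric.mem_closedBall]
        have := dist_triangle (G^[n] y) x c
        linarith
      rw [Function.iterate_succ_apply', pow_succ', mul_assoc]
      calc dist (G (G^[n] y)) x = dist (G (G^[n] y)) (G x) := by rw [hfix.eq]
        _ ≤ K * dist (G^[n] y) x := hG _ h2 _ hx
        _ ≤ _ := mul_le_mul_of_nonneg_left ih hK0
  refine ⟨x, hfix, fun ε hε => ⟨min ε (δ - dist x c), lt_min hε (by linarith), ?_⟩,
    δ - dist x c, by linarith, ?_⟩
  · intro y hy n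
    have h1 := hiter y (hy.trans_le (min_le_right _ _)) n
    exact (h1.trans (mul_le_of_le_one_left dist_nonneg (pow_le_one₀ hK0 hK1.le))).trans_lt
      (hy.trans_le (min_le_left _ _))
  · intro y hy
    rw [tendsto_iff_dist_tendsto_zero]
    have h1 : Tendsto (fun n : ℕ => K ^ n * dist y x) atTop (𝓝 0) := by
      simpa using (tendsto_pow_atTop_nhds_zero_of_lt_one hK0 hK1).mul_const (dist y x)
    exact squeeze_zero (fun _ => dist_nonneg) (hiter y hy) h1

variable {Λ : Type*} {l : Filter Λ} {r : Λ → ℕ∞}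

/-- In the norm ‖T ·‖ the derivative at c is a contraction. C¹ convergence makes the nearby maps
contract a ball of fixed radius, while the displacement of its centre tends to zero. -/
theorem eventually_exists_stable (hr : ∀ n, 1 ≤ r n) {FL F : Λ → Plane → Plane} {A : Plane → Plane}
    {c : Plane} (hc : A c = c) (T : Plane ≃L[ℝ] Plane) {K : ℝ} (hK1 : K < 1)
    (hT : ∀ v, ‖T (fderiv ℝ A c v)‖ ≤ K * ‖T v‖) (h : C1TendstoAt l r FL A c)
    (hF : ∀ᶠ q in l ×ˢ 𝓝 c, F q.1 q.2 = FL q.1 q.2) :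
    ∀ᶠ n in l, ∃ x, IsAsymptoticallyStableFixedPoint (F n) x := by
  have hK0 : 0 ≤ K := by
    have h1 := hT (T.symm !₂[1, 0])
    have h2 : ‖T (T.symm (!₂[1, 0] : Plane))‖ = 1 := by
      rw [T.apply_symm_apply, EuclideanSpace.norm_eq]; simp
    rw [h2, mul_one] at h1
    exact (norm_nonneg _).trans h1
  set S : Plane →L[ℝ] Plane := (T : Plane →L[ℝ] Plane)
  set S' : Plane →L[ℝ] Plane := (T.symm : Plane →L[ℝ] Plane)
  have hSS' : ∀ z, S (S' z) = z := fun z => T.apply_symm_apply z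
  have hS'S : ∀ z, S' (S z) = z := fun z => T.symm_apply_apply z
  have hfix : S (A (S' (S c))) = S c := by rw [hS'S, hc]
  have hconj : C1TendstoAt l r (fun n => S ∘ FL n ∘ S') (S ∘ A ∘ S') (S c) := by
    have h1 : C1TendstoAt l r (fun _ => S') S' (S c) :=
      C1TendstoAt.const (Eventually.of_forall fun _ => S'.contDiff.contDiffAt)
    have h2 : C1TendstoAt l r (fun _ => S) S ((A ∘ S') (S c)) :=
      C1TendstoAt.const (Eventually.of_forall fun _ => S.contDiff.contDiffAt)
    exact h2.comp hr (C1TendstoAt.comp hr (by rwa [hS'S]) h1)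
  have hderiv : ‖fderiv ℝ (S ∘ A ∘ S') (S c)‖ ≤ K := by
    refine ContinuousLinearMap.opNorm_le_bound _ hK0 fun v => ?_
    have hA : HasFDerivAt A (fderiv ℝ A c) (S' (S c)) := by
      rw [hS'S]; exact h.differentiableAt.hasFDerivAt
    have h1 : HasFDerivAt (S ∘ A ∘ S') (S.comp ((fderiv ℝ A c).comp S')) (S c) :=
      S.hasFDerivAt.comp _ (hA.comp _ S'.hasFDerivAt)
    rw [h1.fderiv]
    have h2 := hT (S' v)
    have h3 : T (S' v) = v := hSS' v
    rw [h3] at h2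
    exact h2
  obtain ⟨K', hKK', hK'1⟩ := exists_between hK1
  have hev : ∀ᶠ q in l ×ˢ 𝓝 (S c), DifferentiableAt ℝ (S ∘ FL q.1 ∘ S') q.2 ∧
      ‖fderiv ℝ (S ∘ FL q.1 ∘ S') q.2‖ ≤ K' ∧ (S ∘ FL q.1 ∘ S') q.2 = (S ∘ F q.1 ∘ S') q.2 := by
    have h1 := hconj.tendsto_fderiv.norm.eventually_le_const (hderiv.trans_lt hKK')
    have h2 : Tendsto (fun q : Λ × Plane => (q.1, S' q.2)) (l ×ˢ 𝓝 (S c)) (l ×ˢ 𝓝 c) := by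
      refine tendsto_fst.prodMk ?_
      have := S'.continuous.tendsto (S c)
      rw [hS'S] at this
      exact this.comp tendsto_snd
    filter_upwards [hconj.contDiffAt, h1, h2.eventually hF] with q a1 a2 a3
    exact ⟨a1.differentiableAt (coe_enat_ne_zero (hr _)), a2, by simp [a3]⟩
  obtain ⟨pa, hpa, pb, hpb, H⟩ := eventually_prod_iff.1 hev
  obtain ⟨δ, hδ, hball⟩ := Metric.nhds_basis_closedBall.eventually_iff.1 hpb
  have hcenter : ∀ᶠ n in l, dist ((S ∘ FL n ∘ S') (S c)) (S c) < (1 - K') * δ := by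
    have h1 : Tendsto (fun n => (n, S c)) l (l ×ˢ 𝓝 (S c)) :=
      tendsto_id.prodMk tendsto_const_nhds
    have h2 := hconj.tendsto.comp h1
    have h3 : (S ∘ A ∘ S') (S c) = S c := hfix
    rw [h3] at h2
    have h4 := tendsto_iff_dist_tendsto_zero.1 h2
    exact h4.eventually_lt_const (mul_pos (by linarith) hδ)
  filter_upwards [hpa, hcenter] with n hn hcn
  have hcmem : S c ∈ Metric.closedBall (S c) δ := Metric.mem_closedBall_self hδ.le
  have hn' := fun z (hz : z ∈ Metric.closedBall (S c) δ) => H hn (hball hz)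
  obtain ⟨x, hx⟩ := exists_stable_of_contraction (G := S ∘ F n ∘ S') hδ (hK0.trans hKK'.le) hK'1
    (fun x hx y hy => by
      rw [← (hn' x hx).2.2, ← (hn' y hy).2.2, dist_eq_norm, dist_eq_norm]
      exact (convex_closedBall (S c) δ).norm_image_sub_le_of_norm_fderiv_le
        (fun z hz => (hn' z hz).1) (fun z hz => (hn' z hz).2.1) hy hx)
    (by rwa [← (hn' _ hcmem).2.2])
  refine ⟨T.symm x, hx.conj T.symm.toHomeomorph fun z => ?_⟩
  change S' (S (F n (S' z))) = F n (S' z)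
  rw [hS'S]

end StableFixedPoints
-- Uniform tolerances extracted from sequences.
section Closeness

/-- On the ball of radius `ε⁻¹`, the map `F` is of class `C^r` and `ε`-close to `A` in the `C¹`
sense. -/
structure C1CloseOn (r : ℕ∞) (F A : Plane → Plane) (ε : ℝ) : Prop where
  contDiffOn : ContDiffOn ℝ r F (Metric.ball 0 ε⁻¹)
  norm_sub_le : ∀ z ∈ Metric.ball (0 : Plane) ε⁻¹, ‖F z - A z‖ ≤ ε
  norm_fderiv_sub_le : ∀ z ∈ Metric.ball (0 : Plane) ε⁻¹, ‖fderiv ℝ F z - fderiv ℝ A z‖ ≤ ε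

theorem C1CloseOn.mono {r : ℕ∞} {F A : Plane → Plane} {ε ε' : ℝ} (h : C1CloseOn r F A ε)
    (hε : 0 < ε) (hle : ε ≤ ε') : C1CloseOn r F A ε' := by
  have hsub : Metric.ball (0 : Plane) ε'⁻¹ ⊆ Metric.ball 0 ε⁻¹ :=
    Metric.ball_subset_ball (inv_anti₀ hε hle)
  exact ⟨h.contDiffOn.mono hsub, fun z hz => (h.norm_sub_le z (hsub hz)).trans hle,
    fun z hz => (h.norm_fderiv_sub_le z (hsub hz)).trans hle⟩

theorem eventually_mem_ball_inv (x : Plane) :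
    ∀ᶠ q : ℕ × Plane in atTop ×ˢ 𝓝 x, q.2 ∈ Metric.ball (0 : Plane) (1 / ((q.1 : ℝ) + 1))⁻¹ := by
  obtain ⟨n₀, hn₀⟩ := exists_nat_gt ‖x‖
  have h1 : ∀ᶠ q : ℕ × Plane in atTop ×ˢ 𝓝 x, n₀ ≤ q.1 :=
    tendsto_fst.eventually (eventually_ge_atTop n₀)
  have h2 : ∀ᶠ q : ℕ × Plane in atTop ×ˢ 𝓝 x, ‖q.2‖ < n₀ :=
    (continuous_norm.continuousAt.tendsto.comp
      (tendsto_snd (f := (atTop : Filter ℕ)) (g := 𝓝 x))).eventually_lt_const hn₀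
  filter_upwards [h1, h2] with q a1 a2
  rw [mem_ball_zero_iff, one_div, inv_inv]
  have : (n₀ : ℝ) ≤ q.1 := by exact_mod_cast a1
  linarith

theorem c1TendstoAt_of_closeOn {r : ℕ → ℕ∞} {F : ℕ → Plane → Plane} {A : Plane → Plane}
    (hA : ContDiff ℝ (⊤ : ℕ∞) A) (h : ∀ n : ℕ, C1CloseOn (r n) (F n) A (1 / ((n : ℝ) + 1)))
    (x : Plane) : C1TendstoAt atTop r F A x := by
  have hc : C1TendstoAt (atTop : Filter ℕ) r (fun _ => A) A x :=
    C1TendstoAt.const (Eventually.of_forall fun _ => hA.contDiffAt)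
  have hb := eventually_mem_ball_inv x
  have hzero : Tendsto (fun q : ℕ × Plane => 1 / ((q.1 : ℝ) + 1)) (atTop ×ˢ 𝓝 x) (𝓝 0) :=
    tendsto_one_div_add_atTop_nhds_zero_nat.comp tendsto_fst
  refine ⟨?_, ?_, ?_, hc.differentiableAt⟩
  · filter_upwards [hb] with q hq
    exact (h q.1).contDiffOn.contDiffAt (Metric.isOpen_ball.mem_nhds hq)
  · have h1 : Tendsto (fun q : ℕ × Plane => F q.1 q.2 - A q.2) (atTop ×ˢ 𝓝 x) (𝓝 0) := by
      refine squeeze_zero_norm' ?_ hzero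
      filter_upwards [hb] with q hq using (h q.1).norm_sub_le _ hq
    simpa using h1.add hc.tendsto
  · have h1 : Tendsto (fun q : ℕ × Plane => fderiv ℝ (F q.1) q.2 - fderiv ℝ A q.2) (atTop ×ˢ 𝓝 x)
        (𝓝 0) := by
      refine squeeze_zero_norm' ?_ hzero
      filter_upwards [hb] with q hq using (h q.1).norm_fderiv_sub_le _ hq
    simpa using h1.add hc.tendsto_fderiv

/-- Counterexamples with tolerances 1/(n + 1) would converge in C¹ to the product map and so be
eventually good. The class r may vary along the sequence, which is why ε does not depend on it. -/
theorem NestedBands.exists_isGood_of_closeOn {p : ℕ} [NeZero p] (B : NestedBands p) :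
    ∃ ε > 0, ∀ r : ℕ∞, 1 ≤ r → ∀ (Fs : Bool → Plane → Plane) (F : Plane → Plane),
      (∀ s, C1CloseOn r (Fs s) (tentPiece B.c s) ε) →
      (∀ z ∈ Metric.ball (0 : Plane) ε⁻¹, ∀ s, 0 ≤ sideSign s * z 0 → F z = Fs s z) →
      B.IsGood r F Fs := by
  by_contra! hcon
  choose r hr Fs F h1 h2 h3 using fun n : ℕ => hcon (1 / ((n : ℝ) + 1)) (by positivity)
  have := B.eventually_isGood (l := atTop) hr
    (fun s x => c1TendstoAt_of_closeOn (contDiff_tentPiece _ _) (fun n => h1 n s) x)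
    (fun x => by
      filter_upwards [eventually_mem_ball_inv x] with q hq using h2 q.1 q.2 hq)
  obtain ⟨n, hn⟩ := this.exists
  exact h3 n hn

/-- The linear map `(x, y) ↦ (y, c x)`. -/
noncomputable def swapMap (c : ℝ) : Plane →L[ℝ] Plane :=
  LinearMap.toContinuousLinearMap
    { toFun := fun z => !₂[z 1, c * z 0]
      map_add' := fun x y => by ext i; fin_cases i <;> simp <;> ring
      map_smul' := fun k x => by ext i; fin_cases i <;> simp <;> ring }

theorem swapMap_apply (c : ℝ) (z : Plane) : swapMap c z = !₂[z 1, c * z 0] := rfl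

/-- The linear map `(x, y) ↦ (a x, b x)`. -/
noncomputable def columnMap (a b : ℝ) : Plane →L[ℝ] Plane :=
  LinearMap.toContinuousLinearMap
    { toFun := fun z => !₂[a * z 0, b * z 0]
      map_add' := fun x y => by ext i; fin_cases i <;> simp <;> ring
      map_smul' := fun k x => by ext i; fin_cases i <;> simp <;> ring }

theorem columnMap_apply (a b : ℝ) (z : Plane) : columnMap a b z = !₂[a * z 0, b * z 0] := rfl

theorem norm_columnMap_le (a b : ℝ) : ‖columnMap a b‖ ≤ |a| + |b| := by
  refine ContinuousLinearMap.opNorm_le_bound _ (by positivity) fun z => ?_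
  refine le_of_sq_le_sq ?_ (by positivity)
  rw [mul_pow, EuclideanSpace.norm_sq_eq, EuclideanSpace.norm_sq_eq, columnMap_apply]
  simp only [Fin.sum_univ_two, Real.norm_eq_abs, sq_abs]
  have h1 : a ^ 2 + b ^ 2 ≤ (|a| + |b|) ^ 2 := by
    have := mul_nonneg (abs_nonneg a) (abs_nonneg b)
    nlinarith [sq_abs a, sq_abs b]
  have h2 := mul_le_mul_of_nonneg_right h1 (sq_nonneg (z 0))
  have h3 : 0 ≤ (|a| + |b|) ^ 2 * (z 1) ^ 2 := by positivity
  simp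
  nlinarith

/-- A linear piece of the normal form with vanishing trace, in rescaled coordinates; `σ` is the sign
of the bifurcation parameter. -/
noncomputable def scaledPiece (σ c : ℝ) (z : Plane) : Plane := swapMap c z + !₂[σ - 1, 1]

theorem hasFDerivAt_scaledPiece (σ c : ℝ) (z : Plane) :
    HasFDerivAt (scaledPiece σ c) (swapMap c) z :=
  (swapMap c).hasFDerivAt.add_const _

theorem contDiff_scaledPiece (σ c : ℝ) {n : WithTop ℕ∞} : ContDiff ℝ n (scaledPiece σ c) :=
  (swapMap c).contDiff.add contDiff_const

theorem tentPiece_eq_scaledPiece (c : Bool → ℝ) (s : Bool) :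
    tentPiece c s = scaledPiece 1 (c s) := by
  ext z i
  fin_cases i <;> simp [tentPiece, scaledPiece, swapMap_apply, add_comm]

theorem exists_stable_of_closeOn :
    ∃ ε > 0, ∀ r : ℕ∞, 1 ≤ r → ∀ (FL F : Plane → Plane),
      C1CloseOn r FL (scaledPiece (-1) (1 / 2)) ε →
      (∀ z ∈ Metric.ball (0 : Plane) ε⁻¹, z 0 ≤ 0 → F z = FL z) →
      ∃ x, IsAsymptoticallyStableFixedPoint F x := by
  by_contra! hcon
  choose r hr FL F h1 h2 h3 using fun n : ℕ => hcon (1 / ((n : ℝ) + 1)) (by positivity)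
  -- The fixed point of (x, y) ↦ (y - 2, 1 + x/2); it lies strictly on the left, where only the left
  -- piece acts.
  set c : Plane := !₂[-2, 0] with hc
  have hev : ∀ᶠ q : ℕ × Plane in atTop ×ˢ 𝓝 c, F q.1 q.2 = FL q.1 q.2 := by
    have hco : Tendsto (fun q : ℕ × Plane => q.2 0) (atTop ×ˢ 𝓝 c) (𝓝 (c 0)) :=
      ((by fun_prop : Continuous fun z : Plane => z 0).tendsto c).comp tendsto_snd
    have hc0 : c 0 < 0 := by simp [hc]
    filter_upwards [eventually_mem_ball_inv c, hco.eventually_le_const hc0] with q hq hq'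
      using h2 q.1 q.2 hq hq'
  have := eventually_exists_stable (l := atTop) hr (A := scaledPiece (-1) (1 / 2)) (c := c) ?_
    -- The derivative (x, y) ↦ (y, x/2) has Euclidean norm 1. Weighting the second coordinate by 3/2
    -- brings the norm down to max(2/3, 3/4).
    (diagEquiv 1 (3 / 2) (by norm_num) (by norm_num)) (K := 3 / 4) (by norm_num) ?_
    (c1TendstoAt_of_closeOn (contDiff_scaledPiece _ _) h1 c) hev
  · obtain ⟨n, x, hn⟩ := this.exists
    exact h3 n x hn
  · ext i
    fin_cases i <;> simp [hc, scaledPiece, swapMap_apply] <;> norm_num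
  · intro v
    rw [(hasFDerivAt_scaledPiece _ _ _).fderiv]
    refine le_of_sq_le_sq ?_ (by positivity)
    rw [mul_pow, EuclideanSpace.norm_sq_eq, EuclideanSpace.norm_sq_eq, diagEquiv_apply,
      diagEquiv_apply, swapMap_apply]
    simp only [Fin.sum_univ_two, Real.norm_eq_abs, sq_abs]
    simp
    nlinarith [sq_nonneg (v 0), sq_nonneg (v 1)]

end Closeness

/-! ### Blow-up by |μ| and transport by similarities. -/

section Rescaling

/-- The similarity `z ↦ s (z - w)` of the plane. -/
noncomputable def similarity (s : ℝ) (hs : s ≠ 0) (w : Plane) : Plane ≃ₜ Plane where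
  toFun z := s • (z - w)
  invFun x := s⁻¹ • x + w
  left_inv z := by simp [smul_smul, hs]
  right_inv x := by simp [smul_smul, hs]
  continuous_toFun := by fun_prop
  continuous_invFun := by fun_prop

theorem similarity_apply (s : ℝ) (hs : s ≠ 0) (w z : Plane) :
    similarity s hs w z = s • (z - w) := rfl

theorem similarity_symm_apply (s : ℝ) (hs : s ≠ 0) (w x : Plane) :
    (similarity s hs w).symm x = s⁻¹ • x + w := rfl

variable {s : ℝ} (hs : s ≠ 0) (w : Plane)

theorem contDiff_similarity {n : WithTop ℕ∞} : ContDiff ℝ n (similarity s hs w) :=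
  (contDiff_id.sub contDiff_const).const_smul s

theorem contDiff_similarity_symm {n : WithTop ℕ∞} : ContDiff ℝ n (similarity s hs w).symm :=
  (contDiff_id.const_smul s⁻¹).add contDiff_const

variable {r : ℕ∞}

theorem IsPiecewiseCrClosedCurve.image_similarity (hr : 1 ≤ r) {Γ : Set Plane}
    (h : IsPiecewiseCrClosedCurve r Γ) : IsPiecewiseCrClosedCurve r (similarity s hs w '' Γ) := by
  obtain ⟨p, γ, h1, h2, h3, h4, rfl⟩ := h
  refine ⟨p, fun j => similarity s hs w ∘ γ j, fun j => (contDiff_similarity hs w).comp_contDiffOn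
    (h1 j), fun j t ht => ?_, fun j => congrArg _ (h3 j), fun i j a ha b hb hab =>
    h4 i j a ha b hb ((similarity s hs w).injective hab), ?_⟩
  · have hd := ((((h1 j).differentiableOn (coe_enat_ne_zero hr)) t ht).hasDerivWithinAt.sub_const
      w).const_smul s
    have hd' : HasDerivWithinAt (similarity s hs w ∘ γ j) (s • derivWithin (γ j) (Icc 0 1) t)
      (Icc 0 1) t := hd
    rw [hd'.derivWithin (uniqueDiffOn_Icc zero_lt_one t ht)]
    exact smul_ne_zero hs (h2 j t ht)
  · rw [image_iUnion]
    simp only [image_comp]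

theorem HasPiecewiseCrBoundary.image_similarity (hr : 1 ≤ r) {S : Set Plane}
    (h : HasPiecewiseCrBoundary r S) : HasPiecewiseCrBoundary r (similarity s hs w '' S) := by
  obtain ⟨c, Γ, h1, h2, h3⟩ := h
  refine ⟨c, fun i => similarity s hs w '' Γ i, fun i => (h1 i).image_similarity hs w hr,
    fun i j hij => (disjoint_image_iff (similarity s hs w).injective).2 (h2 hij), ?_⟩
  rw [← Homeomorph.image_frontier, h3, image_iUnion]

theorem IsTrappingRegion.image {F f : Plane → Plane} {Ω : Set Plane} (h : IsTrappingRegion F Ω)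
    (H : Plane ≃ₜ Plane) (hH : Function.Semiconj H F f) : IsTrappingRegion f (H '' Ω) := by
  refine ⟨h.isCompact.image H.continuous, ?_⟩
  rintro _ ⟨_, ⟨z, hz, rfl⟩, rfl⟩
  rw [← H.image_interior, ← hH z]
  exact mem_image_of_mem _ (h.image_subset (mem_image_of_mem _ hz))

/-- The scalar factors of a similarity cancel in the conjugated derivative, so the Euclidean
expansion constant is unchanged. -/
theorem IsPiecewiseCrExpanding.image_similarity (hr : 1 ≤ r) {g g' : Plane → Plane}
    {Ω : Set Plane} (h : IsPiecewiseCrExpanding r g Ω)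
    (hH : Function.Semiconj (similarity s hs w) g g') :
    IsPiecewiseCrExpanding r g' (similarity s hs w '' Ω) := by
  obtain ⟨q, R, hR, lam, hlam, hexp⟩ := h
  set H := similarity s hs w with hHdef
  have hg' : g' = H ∘ g ∘ H.symm := by
    funext x
    have := hH (H.symm x)
    rw [H.apply_symm_apply] at this
    exact this.symm
  have hpre : ∀ S : Set Plane, MapsTo H.symm (H '' S) S := by
    rintro S _ ⟨z, hz, rfl⟩
    rwa [H.symm_apply_apply]
  have hsm : ∀ {G : Plane → Plane} {S : Set Plane}, ContDiffOn ℝ r G S →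
      ContDiffOn ℝ r (H ∘ G ∘ H.symm) (H '' S) := fun {G S} hG =>
    (contDiff_similarity hs w).comp_contDiffOn
      (hG.comp (contDiff_similarity_symm hs w).contDiffOn (hpre S))
  refine ⟨q, fun i => H '' R i, ⟨hR.isCompact.image H.continuous, ?_,
    fun i => H.isOpenMap _ (hR.isOpen i), fun i => (hR.isConnected i).image _ H.continuous.continuousOn,
    fun i => image_mono (hR.subset i), fun i j hij => (disjoint_image_iff H.injective).2
      (hR.disjoint hij), fun i => (hR.boundary i).image_similarity hs w hr, ?_, fun i => ?_,
    fun i => ?_⟩, lam, hlam, ?_⟩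
  · rintro _ ⟨z, hz, rfl⟩
    rw [← hH z]
    exact mem_image_of_mem _ (hR.mapsTo hz)
  · rw [hR.union_closure, image_iUnion]
    simp only [H.image_closure]
  · rw [hg']; exact hsm (hR.contDiffOn i)
  · obtain ⟨V, G, hV, hRV, hG, hE⟩ := hR.extension i
    refine ⟨H '' V, H ∘ G ∘ H.symm, H.isOpenMap _ hV, ?_, hsm hG, ?_⟩
    · rw [← H.image_closure]; exact image_mono hRV
    · rintro _ hx
      rw [hg']
      exact congrArg H (hE (hpre _ hx))
  · rintro x hx v
    obtain ⟨i, z, hz, rfl⟩ := mem_iUnion.1 hx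
    have h1 := hexp z (mem_iUnion.2 ⟨i, hz⟩) v
    have hd : HasFDerivAt g (fderiv ℝ g (H.symm (H z))) (H.symm (H z)) := by
      rw [H.symm_apply_apply]
      exact (((hR.contDiffOn i).contDiffAt ((hR.isOpen i).mem_nhds hz)).differentiableAt
        (coe_enat_ne_zero hr)).hasFDerivAt
    have h2 : HasFDerivAt H.symm (s⁻¹ • ContinuousLinearMap.id ℝ Plane) (H z) :=
      ((hasFDerivAt_id (H z)).const_smul s⁻¹).add_const w
    have h3 : HasFDerivAt g' (s • (fderiv ℝ g (H.symm (H z))).comp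
        (s⁻¹ • ContinuousLinearMap.id ℝ Plane)) (H z) := by
      rw [hg']
      exact ((hd.comp (H z) h2).sub_const w).const_smul s
    rw [h3.fderiv, H.symm_apply_apply]
    simpa [smul_smul, hs] using h1

/-- Being o(‖x‖ + |μ|), the error term has zero joint derivative at the origin; joint C¹ regularity
then keeps the derivative small nearby, uniformly in μ. -/
theorem IsHigherOrder.eventually_small {W : Set (Plane × ℝ)} {E : Plane → ℝ → Plane}
    (hW : IsOpen W) (h0 : (0 : Plane × ℝ) ∈ W) (hE : IsHigherOrder r W E) {κ : ℝ} (hκ : 0 < κ) :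
    ∀ᶠ p in 𝓝 (0 : Plane × ℝ), p ∈ W ∧ ‖E p.1 p.2‖ ≤ κ * (‖p.1‖ + |p.2|) ∧
      ContDiffAt ℝ r (fun x => E x p.2) p.1 ∧ ‖fderiv ℝ (fun x => E x p.2) p.1‖ ≤ κ := by
  set Ê : Plane × ℝ → Plane := fun p => E p.1 p.2 with hÊ
  have hC1 : ∀ p ∈ W, ContDiffAt ℝ 1 Ê p := fun p hp =>
    hE.contDiffOn_one.contDiffAt (hW.mem_nhds hp)
  have hE0 : Ê 0 = 0 := by
    have := (hE.isLittleO.bound one_pos).self_of_nhds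
    simpa [hÊ] using this
  have hder0 : HasFDerivAt Ê (0 : Plane × ℝ →L[ℝ] Plane) 0 := by
    rw [hasFDerivAt_iff_isLittleO_nhds_zero]
    simp only [zero_add, hE0, sub_zero, zero_apply]
    refine hE.isLittleO.trans_isBigO (IsBigO.of_bound 2 (Eventually.of_forall fun p => ?_))
    rw [Real.norm_of_nonneg (by positivity)]
    have h1 := norm_fst_le p
    have h2 := norm_snd_le p
    rw [Real.norm_eq_abs] at h2
    linarith
  have hfd : Tendsto (fun p => ‖fderiv ℝ Ê p‖) (𝓝 0) (𝓝 0) := by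
    have h1 : ContinuousAt (fderiv ℝ Ê) 0 :=
      ((hC1 0 h0).fderiv_right (m := 0) (by simp)).continuousAt
    have h2 := h1.tendsto.norm
    rwa [hder0.fderiv, norm_zero] at h2
  filter_upwards [hW.mem_nhds h0, hE.isLittleO.bound hκ, hfd.eventually_le_const hκ]
    with p hp h1 h2
  rw [Real.norm_of_nonneg (by positivity)] at h1
  refine ⟨hp, h1, ?_, ?_⟩
  · have hopen : IsOpen {x | (x, p.2) ∈ W} := hW.preimage (by fun_prop)
    exact (hE.contDiffOn_state p.2).contDiffAt (hopen.mem_nhds hp)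
  · have hd : HasFDerivAt Ê (fderiv ℝ Ê p) (p.1, p.2) :=
      ((hC1 p hp).differentiableAt one_ne_zero).hasFDerivAt
    have hd' : HasFDerivAt (fun x => E x p.2)
        ((fderiv ℝ Ê p).comp (ContinuousLinearMap.inl ℝ Plane ℝ)) p.1 :=
      HasFDerivAt.comp (g := Ê) (f := fun x : Plane => (x, p.2)) p.1 hd
        (hasFDerivAt_prodMk_left p.1 p.2)
    rw [hd'.fderiv]
    refine (ContinuousLinearMap.opNorm_comp_le _ _).trans ?_
    calc ‖fderiv ℝ Ê p‖ * ‖ContinuousLinearMap.inl ℝ Plane ℝ‖ ≤ ‖fderiv ℝ Ê p‖ * 1 :=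
          mul_le_mul_of_nonneg_left (ContinuousLinearMap.norm_inl_le_one ℝ Plane ℝ)
            (norm_nonneg _)
      _ ≤ κ := by rwa [mul_one]

/-- In coordinates rescaled by `|μ|`, the pieces of a border-collision map are `C¹`-close to a linear
piece of the normal form with vanishing trace. -/
theorem IsHigherOrder.exists_closeOn_rescaled (hr : 1 ≤ r) {W : Set (Plane × ℝ)}
    {E : Plane → ℝ → Plane} (hW : IsOpen W) (h0 : (0 : Plane × ℝ) ∈ W) (hE : IsHigherOrder r W E)
    {ε η : ℝ} (hε : 0 < ε) (hη : 4 * η ≤ ε) (hη' : 4 * η ≤ ε ^ 2) :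
    ∃ μ₀ > 0, ∀ (μ : ℝ) (hμ : |μ| ≠ 0), |μ| < μ₀ →
      (∀ z ∈ Metric.ball (0 : Plane) ε⁻¹, (similarity |μ| hμ !₂[0, 1] z, μ) ∈ W) ∧
      ∀ τ δ c : ℝ, |τ| ≤ η → |δ + c| ≤ η →
        C1CloseOn r ((similarity |μ| hμ !₂[0, 1]).symm ∘
          (fun x => normalFormPiece τ δ μ x + E x μ) ∘ similarity |μ| hμ !₂[0, 1])
          (scaledPiece (μ / |μ|) c) ε := by
  set w : Plane := !₂[0, 1] with hw
  -- M bounds (‖x‖ + |μ|)/|μ| over the rescaled ball, so the error divided by |μ| is at most κM =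
  -- ε/2.
  set M : ℝ := ε⁻¹ + ‖w‖ + 1 with hM
  have hM1 : 1 ≤ M := by have := norm_nonneg w; have := inv_pos.2 hε; linarith
  have hM0 : 0 < M := by linarith
  obtain ⟨ρ, hρ, hball⟩ := Metric.eventually_nhds_iff_ball.1
    (hE.eventually_small hW h0 (κ := ε / (2 * M)) (by positivity))
  refine ⟨ρ / M, by positivity, fun μ hμ hμρ => ?_⟩
  have hμpos : 0 < |μ| := abs_pos.2 (abs_ne_zero.1 hμ)
  rw [lt_div_iff₀ hM0] at hμρ
  set H := similarity |μ| hμ w with hH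
  have hHn : ∀ z ∈ Metric.ball (0 : Plane) ε⁻¹, ‖H z‖ + |μ| ≤ |μ| * M := fun z hz => by
    rw [mem_ball_zero_iff] at hz
    have h1 : ‖H z‖ = |μ| * ‖z - w‖ := by
      rw [hH, similarity_apply, norm_smul, Real.norm_eq_abs, abs_abs]
    have h2 := norm_sub_le z w
    rw [h1, hM]
    nlinarith
  have hmem : ∀ z ∈ Metric.ball (0 : Plane) ε⁻¹, (H z, μ) ∈ Metric.ball (0 : Plane × ℝ) ρ :=
    fun z hz => by
      have h1 := hHn z hz
      rw [mem_ball_zero_iff, Prod.norm_def, max_lt_iff]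
      have h2 := norm_nonneg (H z)
      simp only [Real.norm_eq_abs]
      constructor <;> linarith
  have hκM : ε / (2 * M) ≤ ε / 2 := by
    apply div_le_div_of_nonneg_left hε.le (by norm_num); linarith
  refine ⟨fun z hz => (hball _ (hmem z hz)).1, fun τ δ c hτ hδ => ?_⟩
  have hform : H.symm ∘ (fun x => normalFormPiece τ δ μ x + E x μ) ∘ H = fun z =>
      scaledPiece (μ / |μ|) c z + (columnMap τ (-δ - c) z + |μ|⁻¹ • E (H z) μ) := by
    funext z
    have h1 : |μ|⁻¹ • normalFormPiece τ δ μ (H z) + w =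
        scaledPiece (μ / |μ|) c z + columnMap τ (-δ - c) z := by
      ext i
      fin_cases i
      · simp [normalFormPiece, hH, similarity_apply, hw, scaledPiece, swapMap_apply,
          columnMap_apply]
        field_simp
        ring
      · simp [normalFormPiece, hH, similarity_apply, hw, scaledPiece, swapMap_apply,
          columnMap_apply]
        field_simp
        ring
    simp only [Function.comp_apply]
    rw [hH, similarity_symm_apply, ← hH, smul_add, add_right_comm, h1, add_assoc]
  have hcol : ‖columnMap τ (-δ - c)‖ ≤ 2 * η := by
    refine (norm_columnMap_le _ _).trans ?_
    have : |-δ - c| = |δ + c| := by rw [← abs_neg]; ring_nf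
    rw [this]; linarith
  have hHd : ∀ z, HasFDerivAt H (|μ| • ContinuousLinearMap.id ℝ Plane) z := fun z =>
    ((hasFDerivAt_id z).sub_const w).const_smul |μ|
  rw [hform]
  have hη0 : 0 ≤ η := (abs_nonneg _).trans hτ
  refine ⟨fun z hz => ?_, fun z hz => ?_, fun z hz => ?_⟩
  · have h1 : ContDiffAt ℝ r (fun x => E x μ) (H z) := (hball _ (hmem z hz)).2.2.1
    have h2 : ContDiffAt ℝ r (fun z => E (H z) μ) z :=
      h1.comp z (contDiff_similarity hμ w).contDiffAt
    exact ((contDiff_scaledPiece _ _).contDiffAt.add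
      ((columnMap _ _).contDiff.contDiffAt.add (h2.const_smul _))).contDiffWithinAt
  · have h1 : ‖E (H z) μ‖ ≤ ε / (2 * M) * (‖H z‖ + |μ|) := (hball _ (hmem z hz)).2.1
    have h2 : ‖E (H z) μ‖ ≤ ε / 2 * |μ| := by
      refine h1.trans ((mul_le_mul_of_nonneg_left (hHn z hz) (by positivity)).trans_eq ?_)
      field_simp
    rw [add_sub_cancel_left]
    refine (norm_add_le _ _).trans ?_
    have h3 : ‖columnMap τ (-δ - c) z‖ ≤ 2 * η * ε⁻¹ :=
      (ContinuousLinearMap.le_of_opNorm_le _ hcol z).trans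
        (mul_le_mul_of_nonneg_left (mem_ball_zero_iff.1 hz).le (by positivity))
    -- On a ball of radius ε⁻¹ a linear term of norm 2η grows to 2η/ε; this is the reason for 4η ≤
    -- ε².
    have h4 : 2 * η * ε⁻¹ ≤ ε / 2 := by
      rw [← div_eq_mul_inv, div_le_iff₀ hε]; nlinarith
    have h5 : ‖|μ|⁻¹ • E (H z) μ‖ ≤ ε / 2 := by
      rw [norm_smul, norm_inv, Real.norm_eq_abs, abs_abs, inv_mul_le_iff₀ hμpos]; linarith
    linarith
  · have h1 : ContDiffAt ℝ r (fun x => E x μ) (H z) := (hball _ (hmem z hz)).2.2.1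
    have h2 : ‖fderiv ℝ (fun x => E x μ) (H z)‖ ≤ ε / (2 * M) := (hball _ (hmem z hz)).2.2.2
    have h3 : HasFDerivAt (fun z => E (H z) μ) ((fderiv ℝ (fun x => E x μ) (H z)).comp
        (|μ| • ContinuousLinearMap.id ℝ Plane)) z :=
      (h1.differentiableAt (coe_enat_ne_zero hr)).hasFDerivAt.comp z (hHd z)
    have h4 := (hasFDerivAt_scaledPiece (μ / |μ|) c z).add
      ((columnMap τ (-δ - c)).hasFDerivAt.add (h3.const_smul |μ|⁻¹))
    have h5 : |μ|⁻¹ • (fderiv ℝ (fun x => E x μ) (H z)).comp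
        (|μ| • ContinuousLinearMap.id ℝ Plane) = fderiv ℝ (fun x => E x μ) (H z) := by
      ext1 v
      simp [smul_smul, hμ]
    rw [h5] at h4
    have h6 : fderiv ℝ (fun z => scaledPiece (μ / |μ|) c z +
        (columnMap τ (-δ - c) z + |μ|⁻¹ • E (H z) μ)) z = _ := h4.fderiv
    rw [h6, (hasFDerivAt_scaledPiece _ _ _).fderiv, add_sub_cancel_left]
    refine (norm_add_le _ _).trans ?_
    linarith

end Rescaling

/-! ### Assembly of the theorem. -/

theorem theorem2p1 (N : ℕ) (hN : 1 ≤ N) :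
    ∃ U : Set (ℝ × ℝ × ℝ × ℝ), IsOpen U ∧ U.Nonempty ∧
      ∀ (r : ℕ∞), 1 ≤ r → ∀ (τL δL τR δR : ℝ), (τL, δL, τR, δR) ∈ U →
      ∀ f : ℝ → Plane → Plane, IsBorderCollisionMap r τL δL τR δR f →
        ∃ μ₀ : ℝ, 0 < μ₀ ∧ ∃ m : ℕ, 1 ≤ m ∧
          (∀ μ ∈ Ioo (-μ₀) 0, ∃ x, IsAsymptoticallyStableFixedPoint (f μ) x) ∧
          (∀ μ ∈ Ioo 0 μ₀, ∃ Ω : Fin N → Set Plane,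
            (Pairwise fun i j => Disjoint (Ω i) (Ω j)) ∧
            ∀ i, (Ω i).Nonempty ∧ IsTrappingRegion (f μ) (Ω i) ∧
              IsPiecewiseCrExpanding r (f μ)^[m] (Ω i)) := by
  have hNz : NeZero (2 * N) := ⟨by omega⟩
  obtain ⟨B₀, hB₀⟩ := exists_cyclicBands (2 * N) (by omega)
  obtain ⟨B, rfl⟩ := B₀.exists_nestedBands
  obtain ⟨ε₁, hε₁, hgood⟩ := B.exists_isGood_of_closeOn
  obtain ⟨ε₂, hε₂, hstable⟩ := exists_stable_of_closeOn
  set ε := min ε₁ ε₂ with hεdef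
  have hε : 0 < ε := lt_min hε₁ hε₂
  set η := min ε (ε ^ 2) / 4 with hηdef
  have hη : 0 < η := by positivity
  have hη1 : 4 * η ≤ ε := by rw [hηdef]; linarith [min_le_left ε (ε ^ 2)]
  have hη2 : 4 * η ≤ ε ^ 2 := by rw [hηdef]; linarith [min_le_right ε (ε ^ 2)]
  -- The centre has zero traces and determinants equal to minus the slopes of the skew tent map.
  refine ⟨Metric.ball (0, -B.c false, 0, -B.c true) η, Metric.isOpen_ball,
    ⟨_, Metric.mem_ball_self hη⟩, ?_⟩
  rintro r hr τL δL τR δR hU f ⟨W, EL, ER, hW, h0, hEL, hER, hf⟩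
  simp only [Metric.mem_ball, Prod.dist_eq, max_lt_iff, Real.dist_eq, sub_zero, sub_neg_eq_add]
    at hU
  obtain ⟨hU1, hU2, hU3, hU4⟩ := hU
  obtain ⟨μ₁, hμ₁, hL⟩ := hEL.exists_closeOn_rescaled hr hW h0 hε hη1 hη2
  obtain ⟨μ₂, hμ₂, hR⟩ := hER.exists_closeOn_rescaled hr hW h0 hε hη1 hη2
  -- Two planar steps advance each coordinate by one interval, and there are 2N intervals in the
  -- cycle.
  refine ⟨min μ₁ μ₂, lt_min hμ₁ hμ₂, 2 * (2 * N), by omega, ?_, ?_⟩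
  · rintro μ ⟨hμ1, hμ2⟩
    have hμ : |μ| ≠ 0 := abs_ne_zero.2 hμ2.ne
    have habs : |μ| = -μ := abs_of_neg hμ2
    obtain ⟨hmem, hclose⟩ := hL μ hμ (by linarith [min_le_left μ₁ μ₂])
    have hc := hclose τL δL (B.c false) hU1.le hU2.le
    set H := similarity |μ| hμ !₂[0, 1] with hH
    have hsign : μ / |μ| = -1 := by rw [habs, div_neg, div_self hμ2.ne]
    rw [hsign, hB₀] at hc
    obtain ⟨x, hx⟩ := hstable r hr _ (H.symm ∘ f μ ∘ H) (hc.mono hε (min_le_right _ _)) (by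
      intro z hz hz0
      have hz' := Metric.ball_subset_ball (inv_anti₀ hε (min_le_right ε₁ ε₂)) hz
      have h1 : H z 0 ≤ 0 := by
        simp [hH, similarity_apply]
        exact mul_nonpos_of_nonneg_of_nonpos (abs_nonneg _) hz0
      simp only [Function.comp_apply]
      rw [(hf _ _ (hmem z hz')).1 h1])
    exact ⟨H x, hx.conj H fun z => by simp⟩
  · rintro μ ⟨hμ1, hμ2⟩
    have hμ : |μ| ≠ 0 := abs_ne_zero.2 hμ1.ne'
    have habs : |μ| = μ := abs_of_pos hμ1
    obtain ⟨hmem, hcloseL⟩ := hL μ hμ (by linarith [min_le_left μ₁ μ₂])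
    obtain ⟨-, hcloseR⟩ := hR μ hμ (by linarith [min_le_right μ₁ μ₂])
    have hcL := hcloseL τL δL (B.c false) hU1.le hU2.le
    have hcR := hcloseR τR δR (B.c true) hU3.le hU4.le
    set H := similarity |μ| hμ !₂[0, 1] with hH
    have hsign : μ / |μ| = 1 := by rw [habs, div_self hμ1.ne']
    rw [hsign] at hcL hcR
    have hg := hgood r hr (fun s => if s then
        H.symm ∘ (fun x => normalFormPiece τR δR μ x + ER x μ) ∘ H
      else H.symm ∘ (fun x => normalFormPiece τL δL μ x + EL x μ) ∘ H) (H.symm ∘ f μ ∘ H)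
      (fun s => by
        rw [tentPiece_eq_scaledPiece]
        cases s
        · exact hcL.mono hε (min_le_left _ _)
        · exact hcR.mono hε (min_le_left _ _))
      (fun z hz s hs => by
        have hz' := Metric.ball_subset_ball (inv_anti₀ hε (min_le_left ε₁ ε₂)) hz
        have h1 : H z 0 = |μ| * z 0 := by simp [hH, similarity_apply]
        obtain ⟨h2, h3⟩ := hf _ _ (hmem z hz')
        cases s
        · have h4 : H z 0 ≤ 0 := by
            rw [h1]
            refine mul_nonpos_of_nonneg_of_nonpos (abs_nonneg _) ?_
            simpa [sideSign] using hs
          simp [h2 h4]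
        · have h4 : 0 ≤ H z 0 := by
            rw [h1]
            refine mul_nonneg (abs_nonneg _) ?_
            simpa [sideSign] using hs
          simp [h3 h4])
    obtain ⟨Ω, hdisj, hΩ⟩ := hg.exists_trappingRegions
    have hsemi : Function.Semiconj H (H.symm ∘ f μ ∘ H) (f μ) := fun z => by simp
    refine ⟨fun i => H '' Ω i, fun i j hij => (disjoint_image_iff H.injective).2 (hdisj hij),
      fun i => ⟨(hΩ i).1.image _, (hΩ i).2.1.image H hsemi, ?_⟩⟩
    exact (hΩ i).2.2.image_similarity hμ _ hr (hsemi.iterate_right _)
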